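/- Let $d\in\mathbb N$ and $$\mathrm{HSp}(2d)=\{T\in\mathrm{Mat}(2d,\mathbb C): T^*\mathcal J T=\mathcal J\},\qquad \mathcal J=\begin{pmatrix}0&\mathbf 1_d\\-\mathbf 1_d&0\end{pmatrix},\qquad R_\theta=\begin{pmatrix}\cos(\pi\theta)\mathbf 1_d&-\sin(\pi\theta)\mathbf 1_d\\ \sin(\pi\theta)\mathbf 1_d&\cos(\pi\theta)\mathbf 1_d\end{pmatrix}.$$ Write $\sigma_1(T)\ge\sigma_2(T)\ge\dots\ge\sigma_{2d}(T)$ for the singular values of $T$, $\rho$ for the spectral radius, $\Lambda^dT$ for the map induced by $T$ on the $d$-th exterior power of $\mathbb C^{2d}$, and $$N_d(T)=\sum_{i=1}^d\ln\frac{\sigma_i(T)+\sigma_i(T)^{-1}}2 .$$ (a) Let $(X,\mathfrak A,\mu)$ be a probability space, $f:X\to X$ a measure-preserving map, and $A:X\to\mathrm{HSp}(2d)$ a measurable map with $\ln\|A(\cdot)\|\in L^1(\mu)$. For a measurable $B:X\to\mathrm{HSp}(2d)$ with $\ln\|B(\cdot)\|\in L^1(\mu)$ put $B_n(x)=B(f^{n-1}(x))\cdots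 B(f(x))B(x)$ and $$L_k(f,B)=\lim_{n\to\infty}\frac1n\int_X\ln\sigma_k(B_n(x))\,d\mu(x),\qquad L^d(f,B)=\sum_{k=1}^dL_k(f,B).$$ Then for every $\theta\in[0,1]$ the exponents $L_k(f,R_\theta A)$, $1\le k\le d$, exist (the integrands are $\mu$-integrable and the limits exist and are finite), the functions $\theta\mapsto L^d(f,R_\theta A)$ on $[0,1]$ and $x\mapsto N_d(A(x))$ on $X$ are integrable, and $$\int_0^1L^d(f,R_\theta A)\,d\theta=\int_XN_d(A(x))\,d\mu(x).$$ (b) Let $T_1,\dots,T_n\in\mathrm{HSp}(2d)$. Then the following integrands are integrable on $[0,1]$ and $$\int_0^1N_d(R_\theta T_1R_\theta T_2\cdots R_\theta T_n)\,d\theta=\sum_{j=1}^nN_d(T_j),\qquad \int_0^1\ln\rho\big(\Lambda^d(R_\theta T_1R_\theta T_2\cdots R_\theta T_n)\big)\,d\theta=\sum_{j=1}^nN_d(T_j).$$ -/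

import Mathlib

open MeasureTheory Filter Topology

namespace HSpCocycle

/-- Complex `2d × 2d` matrices, in blocks of size `d`. -/
abbrev Mat2 (d : ℕ) : Type := Matrix (Fin d ⊕ Fin d) (Fin d ⊕ Fin d) ℂ

/-- The standard skew form `𝒥 = (0, 1; -1, 0)`. -/
def skewJ (d : ℕ) : Mat2 d := Matrix.fromBlocks 0 1 (-1) 0

/-- The hermitian-symplectic group `HSp(2d) = {T : T* 𝒥 T = 𝒥}`, as a set of matrices. -/
def HSp (d : ℕ) : Set (Mat2 d) := {T | T.conjTranspose * skewJ d * T = skewJ d}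

/-- The rotation `R_θ = (cos πθ, - sin πθ; sin πθ, cos πθ)`, each entry times the `d × d`
identity. -/
noncomputable def rot (d : ℕ) (θ : ℝ) : Mat2 d :=
  Matrix.fromBlocks
    (((Real.cos (Real.pi * θ) : ℝ) : ℂ) • (1 : Matrix (Fin d) (Fin d) ℂ))
    (-(((Real.sin (Real.pi * θ) : ℝ) : ℂ) • (1 : Matrix (Fin d) (Fin d) ℂ)))
    (((Real.sin (Real.pi * θ) : ℝ) : ℂ) • (1 : Matrix (Fin d) (Fin d) ℂ))
    (((Real.cos (Real.pi * θ) : ℝ) : ℂ) • (1 : Matrix (Fin d) (Fin d) ℂ))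

/-- The operator norm for the Euclidean norm on `ℂ^{2d}`. -/
noncomputable def opNorm {d : ℕ} (T : Mat2 d) : ℝ :=
  ‖Matrix.toEuclideanCLM (n := Fin d ⊕ Fin d) (𝕜 := ℂ) T‖

/-- The singular values of `T` in decreasing order with multiplicity, indexed from `0`:
`sv T i` is the singular value usually written `σ_{i+1}(T)`. -/
noncomputable def sv {d : ℕ} (T : Mat2 d) (i : ℕ) : ℝ :=
  (Matrix.toEuclideanLin T).singularValues i

/-- `N_r(T) = ∑_{i=1}^r ln ((σ_i(T) + σ_i(T)⁻¹) / 2)`. -/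
noncomputable def N {d : ℕ} (r : ℕ) (T : Mat2 d) : ℝ :=
  ∑ i ∈ Finset.range r, Real.log ((sv T i + (sv T i)⁻¹) / 2)

/-- The spectral radius of `Λ^r T`, the map induced by `T` on the `r`-th exterior power
of `ℂ^{2d}`. -/
noncomputable def rhoExt {d : ℕ} (r : ℕ) (T : Mat2 d) : ℝ :=
  (spectralRadius ℂ
    (exteriorPower.map r (Matrix.toLin' T) :
      Module.End ℂ (⋀[ℂ]^r (Fin d ⊕ Fin d → ℂ)))).toReal

/-- `A` is a measurable, logarithmically integrable map into `HSp(2d)`. -/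
structure IsLogIntegrable {X : Type*} [MeasurableSpace X] (μ : Measure X) {d : ℕ}
    (A : X → Mat2 d) : Prop where
  mem : ∀ x, A x ∈ HSp d
  measurable : ∀ i j, Measurable (fun x => A x i j)
  integrable_log : Integrable (fun x => Real.log (opNorm (A x))) μ

/-- The iterates `A_n(x) = A(f^{n-1} x) ⋯ A(f x) A(x)` of the cocycle `(f, A)`. -/
def iter {X : Type*} {d : ℕ} (f : X → X) (A : X → Mat2 d) : ℕ → X → Mat2 d
  | 0, _ => 1
  | n + 1, x => A (f^[n] x) * iter f A n x

/-- The averages `(1/n) ∫ ln σ_{k+1}(A_n(x)) dμ(x)`. -/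
noncomputable def lyapAvg {X : Type*} [MeasurableSpace X] (μ : Measure X) {d : ℕ}
    (f : X → X) (A : X → Mat2 d) (k n : ℕ) : ℝ :=
  (1 / (n : ℝ)) * ∫ x, Real.log (sv (iter f A n x) k) ∂μ

/-- The Lyapunov exponent with index `k` counted from `0`:
`L_{k+1}(f, A) = lim_n (1/n) ∫ ln σ_{k+1}(A_n(x)) dμ(x)`. -/
noncomputable def lyap {X : Type*} [MeasurableSpace X] (μ : Measure X) {d : ℕ}
    (f : X → X) (A : X → Mat2 d) (k : ℕ) : ℝ :=
  limUnder atTop (lyapAvg μ f A k)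

/-- `L^r(f, A) = ∑_{j=1}^r L_j(f, A)`, the sum of the top `r` Lyapunov exponents. -/
noncomputable def lyapSum {X : Type*} [MeasurableSpace X] (μ : Measure X) {d : ℕ}
    (f : X → X) (A : X → Mat2 d) (r : ℕ) : ℝ :=
  ∑ k ∈ Finset.range r, lyap μ f A k

/-- The interleaved product `R_θ T_1 R_θ T_2 ⋯ R_θ T_n`. -/
noncomputable def rotProd {d n : ℕ} (T : Fin n → Mat2 d) (θ : ℝ) : Mat2 d :=
  (List.ofFn (fun j => rot d θ * T j)).prod

end HSpCocycle

/-! A unitary conjugation (the Cayley transform) carries `HSp d` into U(d, d) and `rot d θ` to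
e^{-iπθ} diag(z, 1) with z = e^{2πiθ}. For T in `HSp d`, the lower right block of the transform has
|det| equal to the product of (σ_i + σ_i⁻¹)/2 over the top d singular values
(`norm_det_cayley_block`), so N_d is the logarithm of the modulus of a determinant.

For a product of factors diag(z, 1) S_j this determinant is entire in z. It has no zero in the
closed unit disc, because the factors never increase |v₁|² - |v₂|² (`det_scaledProd_block_ne_zero`).
Its log-modulus is therefore harmonic near the disc, and its circle average is its value at z = 0,
where the block is the product of the blocks of the S_j. This gives `integral_N_rotListProd`, the
first formula of (b).

The other two formulas are limits of this one. On `HSp d`, N_d differs from log ‖Λ^d T‖ by at most d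
log 2. Hence N_d(T^m)/m tends to log ρ(Λ^d T) by Gelfand's formula, and (1/n) ∫ N_d(A_n) dμ tends to
L^d, the exponents existing by subadditivity. For n ≥ 1 the θ-averages of these approximants do not
depend on n (for cocycles by Fubini and invariance of μ). Since rotations are unitary, the
approximants are bounded uniformly in θ, and dominated convergence
(`intervalIntegral_eq_of_tendsto`) finishes. -/

namespace HSpCocycle

open Matrix
open scoped Matrix.Norms.L2Operator

/-! ### Compound matrices as a model of exterior powers. -/

section Compound

variable {I : Type*} [Fintype I] [DecidableEq I]

/-- The standard basis of `ℂ^I`, indexed by an initial segment of `ℕ`. -/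
noncomputable def finBasis (I : Type*) [Fintype I] [DecidableEq I] :
    Module.Basis (Fin (Fintype.card I)) ℂ (I → ℂ) :=
  (Pi.basisFun ℂ I).reindex (Fintype.equivOfCardEq (Fintype.card_fin _)).symm

/-- The `k`-th compound matrix of `T`: the matrix of `Λ^k T` in the standard basis. -/
noncomputable def compound (k : ℕ) (T : Matrix I I ℂ) :
    Matrix (Set.powersetCard (Fin (Fintype.card I)) k)
      (Set.powersetCard (Fin (Fintype.card I)) k) ℂ :=
  LinearMap.toMatrixAlgEquiv ((finBasis I).exteriorPower k)
    (exteriorPower.map k (Matrix.toLin' T))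

theorem compound_mul (k : ℕ) (S T : Matrix I I ℂ) :
    compound k (S * T) = compound k S * compound k T := by
  rw [compound, Matrix.toLin'_mul, exteriorPower.map_comp]
  exact map_mul (LinearMap.toMatrixAlgEquiv ((finBasis I).exteriorPower k)) _ _

@[simp]
theorem compound_one (k : ℕ) : compound k (1 : Matrix I I ℂ) = 1 := by
  rw [compound, Matrix.toLin'_one, exteriorPower.map_id]
  exact map_one (LinearMap.toMatrixAlgEquiv ((finBasis I).exteriorPower k))

theorem compound_pow (k : ℕ) (T : Matrix I I ℂ) (m : ℕ) :
    compound k (T ^ m) = compound k T ^ m := by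
  induction m with
  | zero => simp
  | succ m ih => rw [pow_succ, compound_mul, ih, pow_succ]

theorem compound_apply (k : ℕ) (T : Matrix I I ℂ)
    (s t : Set.powersetCard (Fin (Fintype.card I)) k) :
    compound k T s t = (Matrix.of fun i j : Fin k =>
      T (Fintype.equivOfCardEq (Fintype.card_fin _) (Set.powersetCard.ofFinEmbEquiv.symm s j))
        (Fintype.equivOfCardEq (Fintype.card_fin _)
          (Set.powersetCard.ofFinEmbEquiv.symm t i))).det := by
  rw [compound, LinearMap.toMatrixAlgEquiv_apply, exteriorPower.basis_repr_apply,
    exteriorPower.basis_apply, exteriorPower.map_apply_ιMulti_family,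
    exteriorPower.ιMulti_family, exteriorPower.ιMultiDual_apply_ιMulti]
  congr 1
  ext i j
  simp [finBasis, Matrix.toLin'_apply]

theorem compound_conjTranspose (k : ℕ) (T : Matrix I I ℂ) :
    compound k Tᴴ = (compound k T)ᴴ := by
  ext s t
  rw [Matrix.conjTranspose_apply, compound_apply, compound_apply, ← Matrix.det_conjTranspose]
  rfl

theorem compound_diagonal (k : ℕ) (a : I → ℂ) :
    compound k (diagonal a) = diagonal fun s => ∏ j : Fin k,
      a (Fintype.equivOfCardEq (Fintype.card_fin _)
        (Set.powersetCard.ofFinEmbEquiv.symm s j)) := by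
  ext s t
  -- A minor of diag(a) is the same minor of the identity with its columns rescaled, so
  -- `compound_one` decides which entries vanish.
  have h : compound k (diagonal a) s t = (∏ j : Fin k,
      a (Fintype.equivOfCardEq (Fintype.card_fin _)
        (Set.powersetCard.ofFinEmbEquiv.symm t j))) * (1 : Matrix _ _ ℂ) s t := by
    rw [← compound_one, compound_apply, compound_apply, ← Matrix.det_mul_column]
    congr 1
    ext i j
    simp only [Matrix.of_apply, diagonal_apply, one_apply]
    split_ifs with h
    · rw [h]; simp
    · simp
  rw [h, diagonal_apply, one_apply]
  split_ifs with h
  · rw [h]; simp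
  · simp

theorem compound_mem_unitary (k : ℕ) {U : Matrix I I ℂ} (hU : U ∈ unitary (Matrix I I ℂ)) :
    compound k U ∈ unitary (Matrix (Set.powersetCard (Fin (Fintype.card I)) k)
      (Set.powersetCard (Fin (Fintype.card I)) k) ℂ) := by
  rw [Unitary.mem_iff] at hU ⊢
  simp only [star_eq_conjTranspose] at hU ⊢
  simp only [← compound_conjTranspose, ← compound_mul, hU.1, hU.2, compound_one, and_self]

theorem continuous_compound (k : ℕ) :
    Continuous fun T : Matrix I I ℂ => compound k T := by
  refine continuous_pi fun s => continuous_pi fun t => ?_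
  simp only [compound_apply]
  refine Continuous.matrix_det ?_
  exact continuous_matrix fun i j => Continuous.matrix_elem continuous_id _ _

/-- The spectrum is purely algebraic; passing to matrices makes the C*-norm available for Gelfand's
formula. -/
theorem spectralRadius_exteriorPower_map (k : ℕ) (T : Matrix I I ℂ) :
    spectralRadius ℂ (exteriorPower.map k (Matrix.toLin' T) :
      Module.End ℂ (⋀[ℂ]^k (I → ℂ))) = spectralRadius ℂ (compound k T) := by
  rw [compound, spectralRadius, spectralRadius, AlgEquiv.spectrum_eq]

end Compound

/-! ### The norm of Λ^k T in terms of singular values. -/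

section SingularValues

variable {I : Type*} [Fintype I] [DecidableEq I]

theorem exists_unitary_conjTranspose_mul_self (T : Matrix I I ℂ) :
    ∃ U ∈ unitary (Matrix I I ℂ), Tᴴ * T = U * diagonal (fun i =>
      (((toEuclideanLin T).singularValues
        ((Fintype.equivOfCardEq (Fintype.card_fin (Fintype.card I))).symm i) ^ 2 : ℝ) : ℂ)) *
          star U := by
  have hH : (Tᴴ * T).IsHermitian := isHermitian_conjTranspose_mul_self T
  refine ⟨hH.eigenvectorUnitary, hH.eigenvectorUnitary.2, ?_⟩
  have h := hH.spectral_theorem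
  rw [Unitary.conjStarAlgAut_apply] at h
  refine h.trans ?_
  congr 2
  congr 1
  funext i
  simp only [Function.comp_apply, Matrix.IsHermitian.eigenvalues]
  rw [LinearMap.sq_singularValues_fin _ (finrank_euclideanSpace (𝕜 := ℂ) (ι := I))]
  simp only [Matrix.IsHermitian.eigenvalues₀]
  congr 2
  simp only [Matrix.toEuclideanLin_conjTranspose_eq_adjoint, Matrix.toLpLin_mul_same]

theorem norm_unitary_conj {E : Type*} [NormedRing E] [StarRing E] [CStarRing E]
    {U : E} (hU : U ∈ unitary E) (A : E) : ‖U * A * star U‖ = ‖A‖ := by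
  rw [CStarRing.norm_mul_mem_unitary _ (Unitary.star_mem hU), CStarRing.norm_mem_unitary_mul _ hU]

theorem val_le_orderEmb {k n : ℕ} (f : Fin k ↪o Fin n) (i : Fin k) :
    (i : ℕ) ≤ f i := by
  obtain ⟨i, hi⟩ := i
  induction i with
  | zero => exact Nat.zero_le _
  | succ i ih =>
    have h1 := ih (by omega)
    have h2 : f ⟨i, by omega⟩ < f ⟨i + 1, hi⟩ := f.strictMono (by simp)
    have h3 : (f ⟨i, by omega⟩ : ℕ) < f ⟨i + 1, hi⟩ := h2
    simp only at h1 ⊢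
    omega

/-- By the C*-identity the square of the norm is ‖Λ^k(T* T)‖, and T* T is unitarily diagonal. What
remains is the largest product of k squared singular values with distinct indices; the j-th smallest
index of a k-set is at least j, so the initial segment is optimal. -/
theorem norm_compound {k : ℕ} (hk : k ≤ Fintype.card I) (T : Matrix I I ℂ) :
    ‖compound k T‖ = ∏ i ∈ Finset.range k, (toEuclideanLin T).singularValues i := by
  obtain ⟨U, hU, h⟩ := exists_unitary_conjTranspose_mul_self T
  set σ := (toEuclideanLin T).singularValues with hσ
  have hσ0 : ∀ i, 0 ≤ σ i := LinearMap.singularValues_nonneg _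
  have hanti : Antitone σ := LinearMap.singularValues_antitone _
  have hp : 0 ≤ ∏ i ∈ Finset.range k, σ i := Finset.prod_nonneg fun i _ => hσ0 i
  refine (mul_self_inj (norm_nonneg _) hp).mp ?_
  rw [← l2_opNorm_conjTranspose_mul_self, ← compound_conjTranspose, ← compound_mul, h,
    compound_mul, compound_mul, star_eq_conjTranspose, compound_conjTranspose,
    ← star_eq_conjTranspose, norm_unitary_conj (compound_mem_unitary k hU), compound_diagonal,
    l2_opNorm_diagonal]
  have key : ∀ s : Set.powersetCard (Fin (Fintype.card I)) k,
      ‖∏ j : Fin k, (((σ ((Fintype.equivOfCardEq (Fintype.card_fin (Fintype.card I))).symm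
        (Fintype.equivOfCardEq (Fintype.card_fin _)
          (Set.powersetCard.ofFinEmbEquiv.symm s j))) ^ 2 : ℝ)) : ℂ)‖ =
      ∏ j : Fin k, σ (Set.powersetCard.ofFinEmbEquiv.symm s j) ^ 2 := by
    intro s
    rw [norm_prod]
    refine Finset.prod_congr rfl fun j _ => ?_
    rw [Equiv.symm_apply_apply, Complex.norm_real, Real.norm_of_nonneg (sq_nonneg _)]
  have hprod : (∏ i ∈ Finset.range k, σ i) * ∏ i ∈ Finset.range k, σ i
      = ∏ j : Fin k, σ j ^ 2 := by
    rw [← Finset.prod_mul_distrib, Finset.prod_range]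
    exact Finset.prod_congr rfl fun j _ => (sq _).symm
  rw [hprod]
  refine le_antisymm ?_ ?_
  · refine (pi_norm_le_iff_of_nonneg (Finset.prod_nonneg fun _ _ => sq_nonneg _)).mpr fun s => ?_
    rw [key]
    refine Finset.prod_le_prod (fun _ _ => sq_nonneg _) fun j _ => ?_
    exact pow_le_pow_left₀ (hσ0 _) (hanti (val_le_orderEmb _ j)) 2
  · refine le_trans (le_of_eq ?_) (norm_le_pi_norm _
      (Set.powersetCard.ofFinEmbEquiv (Fin.castLEOrderEmb hk)))
    rw [key]
    refine Finset.prod_congr rfl fun j _ => ?_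
    rw [Equiv.symm_apply_apply]
    rfl

end SingularValues

/-! ### The symmetry σ ↔ σ⁻¹ of the singular values on HSp(2d). -/

section Symmetry

theorem eq_of_antitone_of_map_univ_eq {n : ℕ} {f g : Fin n → ℝ} (hf : Antitone f)
    (hg : Antitone g)
    (h : Multiset.map f Finset.univ.val = Multiset.map g Finset.univ.val) : f = g := by
  rw [Fin.univ_val_map, Fin.univ_val_map, Multiset.coe_eq_coe] at h
  refine List.ofFn_injective (h.eq_of_pairwise' (r := (· ≥ ·)) ?_ ?_)
  · exact (List.sortedGE_ofFn_iff.mpr hf).pairwise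
  · exact (List.sortedGE_ofFn_iff.mpr hg).pairwise

variable {I : Type*} [Fintype I] [DecidableEq I]

theorem roots_charpoly_unitary_conj_diagonal {U : Matrix I I ℂ} (hU : U ∈ unitary (Matrix I I ℂ))
    (a : I → ℂ) :
    (U * diagonal a * star U).charpoly.roots = Multiset.map a Finset.univ.val := by
  rw [Matrix.charpoly_mul_comm, ← mul_assoc, (Unitary.mem_iff.mp hU).1, one_mul,
    Matrix.charpoly_diagonal]
  have h := Polynomial.roots_multiset_prod_X_sub_C (Multiset.map a Finset.univ.val)
  rwa [Multiset.map_map] at h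

variable {d : ℕ}

theorem skewJ_mul_skewJ (d : ℕ) : skewJ d * skewJ d = -1 := by
  rw [skewJ, fromBlocks_multiply, ← fromBlocks_one, fromBlocks_neg]
  simp

theorem one_mem_HSp (d : ℕ) : (1 : Mat2 d) ∈ HSp d := by
  simp [HSp]

theorem mul_mem_HSp {S T : Mat2 d} (hS : S ∈ HSp d) (hT : T ∈ HSp d) : S * T ∈ HSp d := by
  simp only [HSp, Set.mem_ofPred_eq] at *
  calc (S * T)ᴴ * skewJ d * (S * T) = Tᴴ * (Sᴴ * skewJ d * S) * T := by
        rw [conjTranspose_mul]; noncomm_ring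
    _ = skewJ d := by rw [hS, hT]

/-- The inverse of the Gram matrix `Tᴴ T` of a hermitian-symplectic `T` is conjugate to it
by `𝒥`. -/
theorem skewJ_conj_mul_gram {T : Mat2 d} (hT : T ∈ HSp d) :
    (-skewJ d * (Tᴴ * T) * skewJ d) * (Tᴴ * T) = 1 := by
  have h1 : Tᴴ * skewJ d * T = skewJ d := hT
  have h2 : (-skewJ d * Tᴴ * skewJ d) * T = 1 := by
    calc (-skewJ d * Tᴴ * skewJ d) * T = -(skewJ d * (Tᴴ * skewJ d * T)) := by noncomm_ring
      _ = 1 := by rw [h1, skewJ_mul_skewJ, neg_neg]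
  have h3 : T * (-skewJ d * Tᴴ * skewJ d) = 1 := mul_eq_one_comm.mp h2
  -- T* is hermitian-symplectic too, since the left inverse -𝒥 T* 𝒥 of T is also a right inverse.
  -- The extra summand in the next line vanishes because 𝒥² = -1.
  have h4 : T * skewJ d * Tᴴ = skewJ d := by
    calc T * skewJ d * Tᴴ = T * (-skewJ d * Tᴴ * skewJ d) * skewJ d
          + T * skewJ d * Tᴴ * (1 + skewJ d * skewJ d) := by noncomm_ring
      _ = skewJ d := by rw [h3, skewJ_mul_skewJ]; simp
  calc (-skewJ d * (Tᴴ * T) * skewJ d) * (Tᴴ * T)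
      = -skewJ d * Tᴴ * (T * skewJ d * Tᴴ) * T := by noncomm_ring
    _ = (-skewJ d * Tᴴ * skewJ d) * T := by rw [h4]
    _ = 1 := h2

/-- A simultaneous diagonalization of the Gram matrix of a hermitian-symplectic matrix and of
its inverse. -/
theorem exists_unitary_gram {T : Mat2 d} (hT : T ∈ HSp d) :
    (∀ i < Fintype.card (Fin d ⊕ Fin d), 0 < sv T i) ∧
    ∃ U ∈ unitary (Mat2 d), Tᴴ * T = U * diagonal (fun i =>
      ((sv T ((Fintype.equivOfCardEq (Fintype.card_fin
        (Fintype.card (Fin d ⊕ Fin d)))).symm i) ^ 2 : ℝ) : ℂ)) * star U ∧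
      -skewJ d * (Tᴴ * T) * skewJ d = U * diagonal (fun i =>
      ((((sv T ((Fintype.equivOfCardEq (Fintype.card_fin
        (Fintype.card (Fin d ⊕ Fin d)))).symm i))⁻¹ ^ 2 : ℝ)) : ℂ)) * star U := by
  obtain ⟨U, hU, h⟩ := exists_unitary_conjTranspose_mul_self T
  have hU1 := (Unitary.mem_iff.mp hU).1
  have hU2 := (Unitary.mem_iff.mp hU).2
  have hQ := skewJ_conj_mul_gram hT
  change Tᴴ * T = U * diagonal (fun i =>
      ((sv T ((Fintype.equivOfCardEq (Fintype.card_fin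
        (Fintype.card (Fin d ⊕ Fin d)))).symm i) ^ 2 : ℝ) : ℂ)) * star U at h
  have hne : ∀ i, sv T ((Fintype.equivOfCardEq (Fintype.card_fin
        (Fintype.card (Fin d ⊕ Fin d)))).symm i) ≠ 0 := by
    intro i hi
    have hdet : (Tᴴ * T).det ≠ 0 := by
      intro h0
      have := congrArg Matrix.det hQ
      rw [det_mul, h0, mul_zero, det_one] at this
      exact zero_ne_one this
    apply hdet
    rw [h, det_mul, det_mul, det_diagonal, Finset.prod_eq_zero (Finset.mem_univ i), mul_zero,
      zero_mul]
    simp [hi]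
  refine ⟨?_, U, hU, h, ?_⟩
  · intro i hi
    refine lt_of_le_of_ne (LinearMap.singularValues_nonneg _ _) (Ne.symm ?_)
    have := hne (Fintype.equivOfCardEq (Fintype.card_fin _) ⟨i, hi⟩)
    rwa [Equiv.symm_apply_apply] at this
  -- Both sides invert the Gram matrix, one from the left and one from the right.
  · refine left_inv_eq_right_inv hQ ?_
    rw [h]
    set D := diagonal (fun i => ((sv T ((Fintype.equivOfCardEq (Fintype.card_fin
        (Fintype.card (Fin d ⊕ Fin d)))).symm i) ^ 2 : ℝ) : ℂ)) with hD
    calc U * D * star U * (U * diagonal (fun i => ((((sv T ((Fintype.equivOfCardEq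
          (Fintype.card_fin (Fintype.card (Fin d ⊕ Fin d)))).symm i))⁻¹ ^ 2 : ℝ)) : ℂ)) * star U)
        = U * (D * ((star U * U) * diagonal (fun i => ((((sv T ((Fintype.equivOfCardEq
          (Fintype.card_fin (Fintype.card (Fin d ⊕ Fin d)))).symm i))⁻¹ ^ 2 : ℝ)) : ℂ))))
          * star U := by noncomm_ring
      _ = 1 := by
        rw [hU1, one_mul, hD, diagonal_mul_diagonal]
        have : ∀ i, ((sv T ((Fintype.equivOfCardEq (Fintype.card_fin
            (Fintype.card (Fin d ⊕ Fin d)))).symm i) ^ 2 : ℝ) : ℂ) * ((((sv T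
              ((Fintype.equivOfCardEq (Fintype.card_fin (Fintype.card
                (Fin d ⊕ Fin d)))).symm i))⁻¹ ^ 2 : ℝ)) : ℂ) = 1 := by
          intro i
          rw [← Complex.ofReal_mul, ← mul_pow, mul_inv_cancel₀ (hne i)]
          simp
        simp only [this, diagonal_one, mul_one, hU2]

theorem card_sum_fin (d : ℕ) : Fintype.card (Fin d ⊕ Fin d) = d + d := by simp

theorem sv_pos {T : Mat2 d} (hT : T ∈ HSp d) {i : ℕ} (hi : i < d + d) : 0 < sv T i :=
  (exists_unitary_gram hT).1 i (by rwa [card_sum_fin])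

theorem sv_antitone (T : Mat2 d) : Antitone (sv T) :=
  LinearMap.singularValues_antitone _

/-- The Gram matrix is similar, via 𝒥, to its inverse, so the multisets of the σ_i² and of the σ_i⁻²
coincide. Inversion reverses the order, hence the index reflection (counted from 0). -/
theorem sv_symm {T : Mat2 d} (hT : T ∈ HSp d) {i : ℕ} (hi : i < d + d) :
    sv T (d + d - 1 - i) = (sv T i)⁻¹ := by
  obtain ⟨hpos, U, hU, h1, h2⟩ := exists_unitary_gram hT
  have hchar : (-skewJ d * (Tᴴ * T) * skewJ d).charpoly = (Tᴴ * T).charpoly := by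
    rw [Matrix.charpoly_mul_comm]
    congr 1
    rw [← mul_assoc, mul_neg, skewJ_mul_skewJ, neg_neg, one_mul]
  have hr := congrArg Polynomial.roots hchar
  rw [h2, roots_charpoly_unitary_conj_diagonal hU, h1,
    roots_charpoly_unitary_conj_diagonal hU] at hr
  set e := Fintype.equivOfCardEq (Fintype.card_fin (Fintype.card (Fin d ⊕ Fin d)))
  have huniv : (Finset.univ : Finset (Fin d ⊕ Fin d)).val
      = Multiset.map (e ∘ Fin.rev) Finset.univ.val := by
    have := Finset.map_univ_equiv (Fin.revPerm.trans e)
    rw [← this]; rfl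
  have huniv' : (Finset.univ : Finset (Fin d ⊕ Fin d)).val
      = Multiset.map e Finset.univ.val := by
    have := Finset.map_univ_equiv e
    rw [← this]; rfl
  have hl : Multiset.map (fun i : Fin (Fintype.card (Fin d ⊕ Fin d)) => (sv T (Fin.rev i))⁻¹ ^ 2)
        (Finset.univ : Finset (Fin (Fintype.card (Fin d ⊕ Fin d)))).val
      = Multiset.map (fun i : Fin (Fintype.card (Fin d ⊕ Fin d)) => sv T i ^ 2)
        (Finset.univ : Finset (Fin (Fintype.card (Fin d ⊕ Fin d)))).val := by
    apply Multiset.map_injective Complex.ofReal_injective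
    rw [Multiset.map_map, Multiset.map_map]
    conv_lhs at hr => rw [huniv, Multiset.map_map]
    conv_rhs at hr => rw [huniv', Multiset.map_map]
    simpa [Function.comp_def] using hr
  have hfg := eq_of_antitone_of_map_univ_eq ?_ ?_ hl
  · have := congrFun hfg ⟨d + d - 1 - i, by rw [card_sum_fin]; omega⟩
    simp only [Fin.val_rev, card_sum_fin] at this
    have hii : d + d - (d + d - 1 - i + 1) = i := by omega
    rw [hii] at this
    exact (pow_left_inj₀ (sv_pos hT (by omega)).le (inv_nonneg.mpr (sv_pos hT hi).le)
      two_ne_zero).mp this.symm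
  · intro i j hij
    refine pow_le_pow_left₀ (inv_nonneg.mpr (hpos _ (Fin.is_lt _)).le) ?_ 2
    refine inv_anti₀ (hpos _ (Fin.is_lt _)) (sv_antitone T ?_)
    exact Fin.rev_le_rev.mpr hij
  · intro i j hij
    exact pow_le_pow_left₀ (hpos _ (Fin.is_lt _)).le (sv_antitone T hij) 2

theorem one_le_sv {T : Mat2 d} (hT : T ∈ HSp d) {i : ℕ} (hi : i < d) : 1 ≤ sv T i := by
  have h1 := sv_symm hT (i := i) (by omega)
  have h2 : sv T (d + d - 1 - i) ≤ sv T i := sv_antitone T (by omega)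
  have h3 := sv_pos hT (i := i) (by omega)
  rw [h1, inv_le_iff_one_le_mul₀ h3] at h2
  nlinarith

/-- The product of the numbers `(σ_i + σ_i⁻¹) / 2`, `i < d`, as a determinant. -/
theorem det_gram_add_inv {T : Mat2 d} (hT : T ∈ HSp d) :
    (Tᴴ * T + -skewJ d * (Tᴴ * T) * skewJ d + 2).det
      = (((∏ i ∈ Finset.range d, (sv T i + (sv T i)⁻¹)) ^ 4 : ℝ) : ℂ) := by
  obtain ⟨hpos, U, hU, h1, h2⟩ := exists_unitary_gram hT
  have hU1 := (Unitary.mem_iff.mp hU).1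
  have hU2 := (Unitary.mem_iff.mp hU).2
  have h3 : (2 : Mat2 d) = U * diagonal (fun _ => 2) * star U := by
    have : diagonal (fun _ : Fin d ⊕ Fin d => (2 : ℂ)) = 2 := rfl
    rw [this]
    calc (2 : Mat2 d) = 2 * (U * star U) := by rw [hU2, mul_one]
      _ = U * 2 * star U := by noncomm_ring
  set e := Fintype.equivOfCardEq (Fintype.card_fin (Fintype.card (Fin d ⊕ Fin d)))
  rw [h2, h1, h3, ← add_mul, ← add_mul, ← mul_add, ← mul_add, diagonal_add, diagonal_add,
    det_mul_comm, ← mul_assoc, hU1, one_mul, det_diagonal, ← Equiv.prod_comp e]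
  have h4 : ∀ i : Fin (Fintype.card (Fin d ⊕ Fin d)),
      ((sv T (e.symm (e i)) ^ 2 : ℝ) : ℂ) + (((sv T (e.symm (e i)))⁻¹ ^ 2 : ℝ) : ℂ) + 2
        = (((sv T i + (sv T i)⁻¹) ^ 2 : ℝ) : ℂ) := by
    intro i
    rw [Equiv.symm_apply_apply]
    have := hpos i i.2
    norm_cast
    field_simp
    ring
  rw [Finset.prod_congr rfl fun i _ => h4 i, ← Complex.ofReal_prod]
  congr 1
  rw [← Finset.prod_range (fun i => (sv T i + (sv T i)⁻¹) ^ 2), card_sum_fin,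
    Finset.prod_range_add]
  -- The lower half of the singular values contributes the same product as the upper half; together
  -- with the squares this yields the exponent 4.
  have h5 : ∏ x ∈ Finset.range d, (sv T (d + x) + (sv T (d + x))⁻¹) ^ 2
      = ∏ x ∈ Finset.range d, (sv T x + (sv T x)⁻¹) ^ 2 := by
    rw [← Finset.prod_range_reflect]
    refine Finset.prod_congr rfl fun x hx => ?_
    have hx := Finset.mem_range.mp hx
    have := sv_symm hT (i := x) (by omega)
    have h6 : d + d - 1 - x = d + (d - 1 - x) := by omega
    rw [← h6, this, inv_inv, add_comm]
  rw [h5, Finset.prod_pow]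
  ring

end Symmetry

/-! ### The Cayley transform to U(d, d) and N_d as a log-determinant. -/

section Cayley

variable {d : ℕ}

/-- Twice a unitary diagonalizing the skew form and all rotations (up to the factor `√2`). -/
noncomputable def cayleyBasis (d : ℕ) : Mat2 d :=
  fromBlocks 1 1 (-(Complex.I • 1)) (Complex.I • 1)

/-- The Cayley transform, which maps `HSp(2d)` onto `U(d, d)`. -/
noncomputable def cayley (T : Mat2 d) : Mat2 d :=
  (1 / 2 : ℂ) • ((cayleyBasis d)ᴴ * T * cayleyBasis d)

/-- The indefinite form of signature `(d, d)`. -/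
def indef (d : ℕ) : Mat2 d := fromBlocks 1 0 0 (-1)

theorem conjTranspose_mul_cayleyBasis (d : ℕ) :
    (cayleyBasis d)ᴴ * cayleyBasis d = (2 : ℂ) • 1 := by
  rw [cayleyBasis, fromBlocks_conjTranspose, fromBlocks_multiply, ← fromBlocks_one,
    fromBlocks_smul]
  congr 1 <;> simp [smul_smul] <;> module

theorem cayleyBasis_mul_conjTranspose (d : ℕ) :
    cayleyBasis d * (cayleyBasis d)ᴴ = (2 : ℂ) • 1 := by
  rw [cayleyBasis, fromBlocks_conjTranspose, fromBlocks_multiply, ← fromBlocks_one,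
    fromBlocks_smul]
  congr 1 <;> simp [smul_smul] <;> module

theorem cayley_mul (S T : Mat2 d) : cayley (S * T) = cayley S * cayley T := by
  unfold cayley
  rw [smul_mul_smul_comm]
  have h : (cayleyBasis d)ᴴ * S * cayleyBasis d * ((cayleyBasis d)ᴴ * T * cayleyBasis d)
      = (cayleyBasis d)ᴴ * S * (cayleyBasis d * (cayleyBasis d)ᴴ) * T * cayleyBasis d := by
    noncomm_ring
  rw [h, cayleyBasis_mul_conjTranspose]
  simp only [mul_smul_comm, smul_mul_assoc, mul_one, smul_smul, mul_assoc]
  norm_num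

@[simp]
theorem cayley_one : cayley (1 : Mat2 d) = 1 := by
  rw [cayley, mul_one, conjTranspose_mul_cayleyBasis, smul_smul]
  norm_num

theorem cayley_conjTranspose (T : Mat2 d) : cayley Tᴴ = (cayley T)ᴴ := by
  simp [cayley, conjTranspose_mul, mul_assoc]

theorem cayley_add (S T : Mat2 d) : cayley (S + T) = cayley S + cayley T := by
  simp [cayley, mul_add, add_mul]

theorem cayley_smul (c : ℂ) (T : Mat2 d) : cayley (c • T) = c • cayley T := by
  simp [cayley, smul_comm c]

theorem det_cayley (T : Mat2 d) : (cayley T).det = T.det := by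
  have h : (cayley T).det = ((1 / 2 : ℂ) • ((cayleyBasis d)ᴴ * cayleyBasis d)).det * T.det := by
    rw [cayley, det_smul, det_smul, det_mul, det_mul, det_mul]
    ring
  rw [h, conjTranspose_mul_cayleyBasis, smul_smul]
  norm_num

theorem cayley_skewJ (d : ℕ) : cayley (skewJ d) = -Complex.I • indef d := by
  rw [cayley, skewJ, indef, cayleyBasis, fromBlocks_conjTranspose, fromBlocks_multiply,
    fromBlocks_multiply, fromBlocks_smul, fromBlocks_smul]
  congr 1 <;> simp [smul_smul] <;> module

/-- The matrix `diag(z, 1)` in blocks of size `d`. -/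
def blockScale (d : ℕ) (z : ℂ) : Mat2 d := fromBlocks (z • 1) 0 0 1

/-- Rotations act on the two eigenspaces of 𝒥 by e^{iπθ} and e^{-iπθ}. Pulling out the second scalar
leaves a matrix depending holomorphically on z = e^{2πiθ}. -/
theorem cayley_rot (d : ℕ) (θ : ℝ) :
    cayley (rot d θ) = Complex.exp (-(Real.pi * θ * Complex.I)) •
      blockScale d (Complex.exp (2 * Real.pi * θ * Complex.I)) := by
  have h1 : Complex.exp (-(Real.pi * θ * Complex.I))
      = Complex.cos (Real.pi * θ) - Complex.sin (Real.pi * θ) * Complex.I := by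
    rw [← neg_mul, Complex.exp_mul_I, Complex.cos_neg, Complex.sin_neg]; ring
  have h2 : Complex.exp (-(Real.pi * θ * Complex.I)) *
      Complex.exp (2 * Real.pi * θ * Complex.I)
      = Complex.cos (Real.pi * θ) + Complex.sin (Real.pi * θ) * Complex.I := by
    rw [← Complex.exp_add, ← Complex.exp_mul_I]; congr 1; ring
  have hI : Complex.I * Complex.I = -1 := Complex.I_mul_I
  rw [cayley, rot, cayleyBasis, fromBlocks_conjTranspose, fromBlocks_multiply,
    fromBlocks_multiply, fromBlocks_smul, blockScale, fromBlocks_smul, smul_smul, h2, h1]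
  push_cast
  congr 1 <;> simp [smul_smul, ← add_smul, ← neg_smul]
  · congr 1
    linear_combination (-Complex.cos (Real.pi * θ) / 2) * hI
  · left
    linear_combination Complex.cos (Real.pi * θ) * hI
  · left
    linear_combination Complex.cos (Real.pi * θ) * hI
  · congr 1
    linear_combination (-Complex.cos (Real.pi * θ) / 2) * hI

theorem cayley_mem {T : Mat2 d} (hT : T ∈ HSp d) :
    (cayley T)ᴴ * indef d * cayley T = indef d := by
  have h := congrArg cayley (show Tᴴ * skewJ d * T = skewJ d from hT)
  rw [cayley_mul, cayley_mul, cayley_conjTranspose, cayley_skewJ, mul_smul_comm,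
    smul_mul_assoc] at h
  exact smul_right_injective _ (neg_ne_zero.mpr Complex.I_ne_zero) h

theorem indef_mul_indef (d : ℕ) : indef d * indef d = 1 := by
  simp [indef, fromBlocks_multiply]

/-- The relations between the blocks of an element of `U(d, d)`. -/
theorem block_relations {A B C D : Matrix (Fin d) (Fin d) ℂ}
    (h : (fromBlocks A B C D)ᴴ * indef d * fromBlocks A B C D = indef d) :
    Aᴴ * A - Cᴴ * C = 1 ∧ Bᴴ * B - Dᴴ * D = -1 ∧ A * Aᴴ - B * Bᴴ = 1 := by
  have h1 : (indef d * (fromBlocks A B C D)ᴴ * indef d) * fromBlocks A B C D = 1 := by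
    rw [mul_assoc, mul_assoc, ← mul_assoc _ (indef d), h, indef_mul_indef]
  have h2 := mul_eq_one_comm.mp h1
  rw [indef, fromBlocks_conjTranspose, fromBlocks_multiply, fromBlocks_multiply,
    fromBlocks_inj] at h
  rw [indef, fromBlocks_conjTranspose, fromBlocks_multiply, fromBlocks_multiply,
    fromBlocks_multiply, ← fromBlocks_one, fromBlocks_inj] at h2
  obtain ⟨e1, -, -, e4⟩ := h
  obtain ⟨g1, -, -, -⟩ := h2
  simp only [mul_one, mul_zero, add_zero, mul_neg, zero_add, neg_mul, one_mul,
    zero_mul] at e1 e4 g1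
  exact ⟨by rw [sub_eq_add_neg, e1], by rw [sub_eq_add_neg, e4],
    by rw [sub_eq_add_neg, g1]⟩

/-- A A* = 1 + B B* and D* D = 1 + B* B have equal determinants by Sylvester's identity. -/
theorem norm_det_block_eq {A B C D : Matrix (Fin d) (Fin d) ℂ}
    (h : (fromBlocks A B C D)ᴴ * indef d * fromBlocks A B C D = indef d) :
    ‖A.det‖ = ‖D.det‖ := by
  obtain ⟨-, h2, h4⟩ := block_relations h
  have e1 : A * Aᴴ = 1 + B * Bᴴ := by rw [← h4]; abel
  have e2 : Dᴴ * D = 1 + Bᴴ * B := by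
    rw [← sub_eq_zero]
    calc Dᴴ * D - (1 + Bᴴ * B) = -(Bᴴ * B - Dᴴ * D) - 1 := by abel
      _ = 0 := by rw [h2]; simp
  have e3 : (A * Aᴴ).det = (Dᴴ * D).det := by
    rw [e1, e2, det_one_add_mul_comm]
  rw [det_mul, det_mul, det_conjTranspose, det_conjTranspose] at e3
  have e4 := congrArg norm e3
  rw [norm_mul, norm_mul, norm_star, norm_star] at e4
  exact (mul_self_inj (norm_nonneg _) (norm_nonneg _)).mp e4

/-- Conjugation by `indef d` flips the sign of the off-diagonal blocks, so they cancel in the sum.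
On the diagonal, C* C = A* A - 1 and B* B = D* D - 1 produce a constant that the summand 2 removes.
-/
theorem gram_add_conj_block {A B C D : Matrix (Fin d) (Fin d) ℂ}
    (h : (fromBlocks A B C D)ᴴ * indef d * fromBlocks A B C D = indef d) :
    (fromBlocks A B C D)ᴴ * fromBlocks A B C D
        + indef d * ((fromBlocks A B C D)ᴴ * fromBlocks A B C D) * indef d + 2
      = (4 : ℂ) • fromBlocks (Aᴴ * A) 0 0 (Dᴴ * D) := by
  obtain ⟨h1, h2, -⟩ := block_relations h
  have e1 : Cᴴ * C = Aᴴ * A - 1 := by rw [← h1]; abel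
  have e2 : Bᴴ * B = Dᴴ * D - 1 := by
    rw [sub_eq_iff_eq_add.mp h2]; abel
  have e3 : (2 : Mat2 d) = fromBlocks 2 0 0 2 := by
    have : (2 : Mat2 d) = 1 + 1 := by norm_num
    rw [this, ← fromBlocks_one, fromBlocks_add]
    norm_num
  rw [e3, indef, fromBlocks_conjTranspose, fromBlocks_multiply, fromBlocks_multiply,
    fromBlocks_multiply, fromBlocks_add, fromBlocks_add, fromBlocks_smul, e1, e2]
  have h4 : ∀ X : Matrix (Fin d) (Fin d) ℂ, (4 : ℂ) • X = X + X + X + X := fun X => by module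
  have h5 : (2 : Matrix (Fin d) (Fin d) ℂ) = 1 + 1 := by norm_num
  simp only [h4]
  rw [h5]
  congr 1 <;> simp <;> abel

/-- The determinant of G + G⁻¹ + 2, with G the Gram matrix, is computed twice: by singular values in
`det_gram_add_inv`, and by blocks after the Cayley transform. -/
theorem norm_det_cayley_block {T : Mat2 d} (hT : T ∈ HSp d) :
    ‖(cayley T).toBlocks₂₂.det‖ = ∏ i ∈ Finset.range d, ((sv T i + (sv T i)⁻¹) / 2) := by
  have h := cayley_mem hT
  obtain ⟨A, B, C, D, hS⟩ : ∃ A B C D, cayley T = fromBlocks A B C D :=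
    ⟨_, _, _, _, (fromBlocks_toBlocks _).symm⟩
  have h1 := det_gram_add_inv hT
  have h2 : cayley (2 : Mat2 d) = 2 := by
    have : (2 : Mat2 d) = 1 + 1 := by norm_num
    rw [this, cayley_add, cayley_one]
  have h3 : cayley (-skewJ d * (Tᴴ * T) * skewJ d)
      = indef d * ((cayley T)ᴴ * cayley T) * indef d := by
    rw [← neg_one_smul ℂ (skewJ d), cayley_mul, cayley_mul, cayley_mul, cayley_smul,
      cayley_skewJ, cayley_conjTranspose]
    simp only [smul_smul, mul_smul_comm, smul_mul_assoc]
    norm_num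
  rw [← det_cayley, cayley_add, cayley_add, cayley_mul, h2, h3, cayley_conjTranspose, hS] at h1
  rw [hS] at h
  rw [gram_add_conj_block h, det_smul, det_fromBlocks_zero₂₁, det_mul, det_mul,
    det_conjTranspose, det_conjTranspose] at h1
  rw [hS, toBlocks_fromBlocks₂₂]
  have h4 := congrArg norm h1
  rw [norm_mul, norm_mul, norm_mul, norm_mul, norm_star, norm_star, norm_det_block_eq h,
    Complex.norm_real, norm_pow, norm_pow, card_sum_fin] at h4
  have hpos : ∀ i ∈ Finset.range d, 0 ≤ sv T i + (sv T i)⁻¹ := fun i hi => by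
    have := sv_pos hT (i := i) (by have := Finset.mem_range.mp hi; omega)
    positivity
  have hp := Finset.prod_nonneg hpos
  rw [Real.norm_of_nonneg hp] at h4
  -- The scalar 4 on a space of dimension 2d contributes 4^{2d} = (2^d)^4.
  have h5 : (2 ^ d * ‖D.det‖) ^ 4 = (∏ i ∈ Finset.range d, (sv T i + (sv T i)⁻¹)) ^ 4 := by
    rw [← h4]
    have : ‖(4 : ℂ)‖ = 2 ^ 2 := by norm_num
    rw [this, ← pow_mul, mul_pow, ← pow_mul, show 2 * (d + d) = d * 4 by ring]
    ring
  have h6 := (pow_left_inj₀ (by positivity) hp (by norm_num)).mp h5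
  rw [Finset.prod_div_distrib, ← h6]
  simp

theorem N_eq_log_norm_det {T : Mat2 d} (hT : T ∈ HSp d) :
    N d T = Real.log ‖(cayley T).toBlocks₂₂.det‖ := by
  rw [norm_det_cayley_block hT, Real.log_prod]
  · rfl
  · intro i hi
    have := sv_pos hT (i := i) (by have := Finset.mem_range.mp hi; omega)
    positivity

end Cayley

/-! ### Zero-free determinants and the mean value property. -/

section MeanValue

variable {d : ℕ}

/-- The indefinite quadratic form `|v₁|² - |v₂|²`. -/
def indefForm (v : Fin d ⊕ Fin d → ℂ) : ℝ :=
  ∑ i, Complex.normSq (v (Sum.inl i)) - ∑ i, Complex.normSq (v (Sum.inr i))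

theorem ofReal_indefForm (v : Fin d ⊕ Fin d → ℂ) :
    (indefForm v : ℂ) = star v ⬝ᵥ (indef d *ᵥ v) := by
  simp [indefForm, indef, fromBlocks_mulVec, dotProduct, Complex.normSq_eq_conj_mul_self,
    sub_eq_add_neg, Matrix.neg_mulVec]

theorem indefForm_mulVec {S : Mat2 d} (hS : Sᴴ * indef d * S = indef d)
    (v : Fin d ⊕ Fin d → ℂ) : indefForm (S *ᵥ v) = indefForm v := by
  apply Complex.ofReal_injective
  rw [ofReal_indefForm, ofReal_indefForm, star_mulVec, ← dotProduct_mulVec, mulVec_mulVec,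
    mulVec_mulVec, hS]

theorem indefForm_blockScale_le {z : ℂ} (hz : ‖z‖ ≤ 1) (v : Fin d ⊕ Fin d → ℂ) :
    indefForm (blockScale d z *ᵥ v) ≤ indefForm v := by
  have h1 : ∀ i, (blockScale d z *ᵥ v) (Sum.inl i) = z * v (Sum.inl i) := by
    intro i; simp [blockScale, fromBlocks_mulVec, Matrix.smul_mulVec]
  have h2 : ∀ i, (blockScale d z *ᵥ v) (Sum.inr i) = v (Sum.inr i) := by
    intro i; simp [blockScale, fromBlocks_mulVec]
  unfold indefForm
  simp only [h1, h2, Complex.normSq_mul]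
  gcongr with i
  have : Complex.normSq z ≤ 1 := by
    rw [Complex.normSq_eq_norm_sq]; exact pow_le_one₀ (norm_nonneg _) hz
  exact mul_le_of_le_one_left (Complex.normSq_nonneg _) this

/-- The product `diag(z, 1) S₁ diag(z, 1) S₂ ⋯`. -/
def scaledProd (l : List (Mat2 d)) (z : ℂ) : Mat2 d :=
  (l.map fun S => blockScale d z * S).prod

theorem indefForm_scaledProd_le {l : List (Mat2 d)} (hl : ∀ S ∈ l, Sᴴ * indef d * S = indef d)
    {z : ℂ} (hz : ‖z‖ ≤ 1) (v : Fin d ⊕ Fin d → ℂ) :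
    indefForm (scaledProd l z *ᵥ v) ≤ indefForm v := by
  induction l with
  | nil => simp [scaledProd]
  | cons S l ih =>
    have h : scaledProd (S :: l) z *ᵥ v
        = blockScale d z *ᵥ (S *ᵥ (scaledProd l z *ᵥ v)) := by
      simp [scaledProd, mulVec_mulVec, mul_assoc]
    rw [h]
    refine (indefForm_blockScale_le hz _).trans ?_
    rw [indefForm_mulVec (hl S (by simp))]
    exact ih fun S hS => hl S (by simp [hS])

/-- A kernel vector v of the block would send (0, v), on which the form is negative, to some (w, 0),
on which it is nonnegative; but the form cannot increase. -/
theorem det_scaledProd_block_ne_zero {l : List (Mat2 d)}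
    (hl : ∀ S ∈ l, Sᴴ * indef d * S = indef d) {z : ℂ} (hz : ‖z‖ ≤ 1) :
    (scaledProd l z).toBlocks₂₂.det ≠ 0 := by
  intro h0
  obtain ⟨v, hv, h⟩ := Matrix.exists_mulVec_eq_zero_iff.mpr h0
  have h1 := indefForm_scaledProd_le hl hz (Sum.elim 0 v)
  have h2 : ∀ i, (scaledProd l z *ᵥ Sum.elim 0 v) (Sum.inr i) = 0 := by
    intro i
    have := congrFun h i
    simpa [mulVec, dotProduct, toBlocks₂₂] using this
  have h3 : 0 ≤ indefForm (scaledProd l z *ᵥ Sum.elim 0 v) := by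
    unfold indefForm
    simp only [h2, map_zero, Finset.sum_const_zero, sub_zero]
    exact Finset.sum_nonneg fun _ _ => Complex.normSq_nonneg _
  have h4 : indefForm (Sum.elim 0 v : Fin d ⊕ Fin d → ℂ) < 0 := by
    obtain ⟨i, hi⟩ := Function.ne_iff.mp hv
    simp only [indefForm, Sum.elim_inl, Sum.elim_inr, Pi.zero_apply, map_zero,
      Finset.sum_const_zero, zero_sub, neg_lt_zero]
    exact Finset.sum_pos' (fun _ _ => Complex.normSq_nonneg _)
      ⟨i, Finset.mem_univ _, Complex.normSq_pos.mpr hi⟩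
  linarith

/-- At z = 0 each factor loses its upper block row. The vanishing upper right block is carried along
because it removes the cross term in the induction; the upper left one is not zero for the empty
product. -/
theorem scaledProd_zero_block (l : List (Mat2 d)) :
    (scaledProd l 0).toBlocks₁₂ = 0 ∧
      (scaledProd l 0).toBlocks₂₂ = (l.map toBlocks₂₂).prod := by
  induction l with
  | nil => simp [scaledProd, ← fromBlocks_one]
  | cons S l ih =>
    obtain ⟨A, B, C, D, hS⟩ : ∃ A B C D, S = fromBlocks A B C D :=
      ⟨_, _, _, _, (fromBlocks_toBlocks _).symm⟩
    obtain ⟨A', B', C', D', hM⟩ : ∃ A B C D, scaledProd l 0 = fromBlocks A B C D :=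
      ⟨_, _, _, _, (fromBlocks_toBlocks _).symm⟩
    have h : scaledProd (S :: l) 0 = blockScale d 0 * S * scaledProd l 0 := by
      simp [scaledProd]
    rw [hM, toBlocks_fromBlocks₁₂, toBlocks_fromBlocks₂₂] at ih
    rw [h, hM, hS, blockScale, fromBlocks_multiply, fromBlocks_multiply]
    simp [ih.1, ih.2, toBlocks_fromBlocks₁₂, toBlocks_fromBlocks₂₂]

theorem differentiable_scaledProd (l : List (Mat2 d)) (i j : Fin d ⊕ Fin d) :
    Differentiable ℂ fun z => scaledProd l z i j := by
  induction l generalizing i j with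
  | nil => simp [scaledProd]
  | cons S l ih =>
    have h : ∀ z, scaledProd (S :: l) z = blockScale d z * S * scaledProd l z := by
      intro z; simp [scaledProd]
    simp only [h, mul_apply]
    have hb : ∀ i j, Differentiable ℂ fun z => blockScale d z i j := by
      rintro (i | i) (j | j) <;> simp [blockScale]
    fun_prop

theorem differentiable_det_scaledProd_block (l : List (Mat2 d)) :
    Differentiable ℂ fun z => (scaledProd l z).toBlocks₂₂.det := by
  simp only [det_apply]
  have := differentiable_scaledProd l
  simp only [toBlocks₂₂, of_apply]
  fun_prop

theorem circleAverage_log_norm_det {l : List (Mat2 d)}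
    (hl : ∀ S ∈ l, Sᴴ * indef d * S = indef d) :
    Real.circleAverage (fun z => Real.log ‖(scaledProd l z).toBlocks₂₂.det‖) 0 1
      = (l.map fun S => Real.log ‖S.toBlocks₂₂.det‖).sum := by
  rw [InnerProductSpace.HarmonicOnNhd.circleAverage_eq]
  · have hne : ∀ S ∈ l, ‖S.toBlocks₂₂.det‖ ≠ 0 := by
      intro S hS
      -- For a one-element list at z = 0 the block is that of S itself.
      have h := det_scaledProd_block_ne_zero (l := [S]) (z := 0) (by simpa using hl S hS)
        (by simp)
      rw [(scaledProd_zero_block [S]).2] at h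
      simpa using h
    rw [(scaledProd_zero_block l).2]
    clear hl
    induction l with
    | nil => simp
    | cons S l ih =>
      have h2 : ‖((l.map toBlocks₂₂).prod).det‖ ≠ 0 := by
        rw [← coe_detMonoidHom, map_list_prod, ← coe_nnnorm]
        have : (nnnorm : ℂ → NNReal) = (nnnormHom : ℂ →*₀ NNReal) := rfl
        rw [this, map_list_prod]
        simp only [ne_eq, NNReal.coe_eq_zero, List.prod_eq_zero_iff]
        intro h
        simp only [List.map_map, List.mem_map] at h
        obtain ⟨T, hT, h⟩ := h
        exact hne T (by simp [hT]) (by simpa using h)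
      rw [List.map_cons, List.prod_cons, det_mul, norm_mul,
        Real.log_mul (hne S (by simp)) h2, ih fun S hS => hne S (by simp [hS])]
      simp
  · intro z hz
    refine AnalyticAt.harmonicAt_log_norm ?_ ?_
    · exact (differentiable_det_scaledProd_block l).analyticAt z
    · exact det_scaledProd_block_ne_zero hl (by simpa using hz)

theorem circleAverage_eq_integral_exp (g : ℂ → ℝ) :
    ∫ θ in (0 : ℝ)..1, g (Complex.exp (2 * Real.pi * θ * Complex.I))
      = Real.circleAverage g 0 1 := by
  have h := intervalIntegral.integral_comp_mul_left (a := 0) (b := 1)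
    (fun t => g (circleMap 0 1 t)) (c := 2 * Real.pi) (by positivity)
  rw [mul_zero, mul_one] at h
  rw [Real.circleAverage, ← h]
  refine intervalIntegral.integral_congr fun θ _ => ?_
  simp [circleMap]

end MeanValue

/-! ### Averaging N_d over rotated finite products. -/

section RotatedProducts

variable {d : ℕ}

theorem rot_mem_HSp (d : ℕ) (θ : ℝ) : rot d θ ∈ HSp d := by
  have h : Real.cos (Real.pi * θ) * Real.cos (Real.pi * θ)
      + Real.sin (Real.pi * θ) * Real.sin (Real.pi * θ) = 1 := by
    rw [← sq, ← sq, Real.cos_sq_add_sin_sq]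
  change (rot d θ)ᴴ * skewJ d * rot d θ = skewJ d
  rw [rot, skewJ, fromBlocks_conjTranspose, fromBlocks_multiply, fromBlocks_multiply]
  congr 1 <;> simp [smul_smul, ← add_smul, -Complex.ofReal_cos, -Complex.ofReal_sin]
  · module
  · rw [add_comm, h, one_smul]
  · rw [← neg_add, ← add_smul, h, one_smul]
  · module

theorem rot_mem_unitary (d : ℕ) (θ : ℝ) : rot d θ ∈ unitary (Mat2 d) := by
  have h : Real.cos (Real.pi * θ) * Real.cos (Real.pi * θ)
      + Real.sin (Real.pi * θ) * Real.sin (Real.pi * θ) = 1 := by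
    rw [← sq, ← sq, Real.cos_sq_add_sin_sq]
  have h1 : (rot d θ)ᴴ * rot d θ = 1 := by
    rw [rot, fromBlocks_conjTranspose, fromBlocks_multiply, ← fromBlocks_one]
    congr 1 <;> simp [smul_smul, ← add_smul, -Complex.ofReal_cos, -Complex.ofReal_sin]
    · rw [h, one_smul]
    · module
    · module
    · rw [add_comm, h, one_smul]
  exact Unitary.mem_iff.mpr ⟨h1, mul_eq_one_comm.mp h1⟩

/-- The product `R_θ T₁ R_θ T₂ ⋯` along a list. -/
noncomputable def rotListProd (l : List (Mat2 d)) (θ : ℝ) : Mat2 d :=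
  (l.map fun T => rot d θ * T).prod

theorem rotProd_eq_rotListProd {n : ℕ} (T : Fin n → Mat2 d) (θ : ℝ) :
    rotProd T θ = rotListProd (List.ofFn T) θ := by
  rw [rotProd, rotListProd, List.map_ofFn]
  rfl

theorem rotListProd_mem {l : List (Mat2 d)} (hl : ∀ T ∈ l, T ∈ HSp d) (θ : ℝ) :
    rotListProd l θ ∈ HSp d := by
  induction l with
  | nil => simpa [rotListProd] using one_mem_HSp d
  | cons S l ih =>
    have : rotListProd (S :: l) θ = rot d θ * S * rotListProd l θ := by simp [rotListProd]
    rw [this]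
    exact mul_mem_HSp (mul_mem_HSp (rot_mem_HSp d θ) (hl S (by simp)))
      (ih fun T hT => hl T (by simp [hT]))

/-- The scalars e^{-iπθ} split off by `cayley_rot` have modulus one and drop out of the norm. -/
theorem norm_det_cayley_rotListProd (l : List (Mat2 d)) (θ : ℝ) :
    ‖(cayley (rotListProd l θ)).toBlocks₂₂.det‖ = ‖(scaledProd (l.map cayley)
      (Complex.exp (2 * Real.pi * θ * Complex.I))).toBlocks₂₂.det‖ := by
  have h : ∃ c : ℂ, ‖c‖ = 1 ∧ cayley (rotListProd l θ) =
      c • scaledProd (l.map cayley) (Complex.exp (2 * Real.pi * θ * Complex.I)) := by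
    induction l with
    | nil => exact ⟨1, by simp, by simp [rotListProd, scaledProd]⟩
    | cons S l ih =>
      obtain ⟨c, hc, h⟩ := ih
      refine ⟨Complex.exp (-(Real.pi * θ * Complex.I)) * c, ?_, ?_⟩
      · rw [norm_mul, hc, mul_one, Complex.norm_exp]
        simp
      · have h1 : rotListProd (S :: l) θ = rot d θ * S * rotListProd l θ := by
          simp [rotListProd]
        rw [h1, cayley_mul, cayley_mul, h, cayley_rot]
        simp [scaledProd, smul_smul, mul_comm c]
  obtain ⟨c, hc, h⟩ := h
  have h1 : (c • scaledProd (l.map cayley)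
      (Complex.exp (2 * Real.pi * θ * Complex.I))).toBlocks₂₂ = c • (scaledProd (l.map cayley)
      (Complex.exp (2 * Real.pi * θ * Complex.I))).toBlocks₂₂ := rfl
  rw [h, h1, det_smul, norm_mul, norm_pow, hc, one_pow, one_mul]

theorem N_rotListProd {l : List (Mat2 d)} (hl : ∀ T ∈ l, T ∈ HSp d) (θ : ℝ) :
    N d (rotListProd l θ) = Real.log ‖(scaledProd (l.map cayley)
      (Complex.exp (2 * Real.pi * θ * Complex.I))).toBlocks₂₂.det‖ := by
  rw [N_eq_log_norm_det (rotListProd_mem hl θ), norm_det_cayley_rotListProd]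

theorem map_cayley_mem {l : List (Mat2 d)} (hl : ∀ T ∈ l, T ∈ HSp d) :
    ∀ S ∈ l.map cayley, Sᴴ * indef d * S = indef d := by
  intro S hS
  obtain ⟨T, hT, rfl⟩ := List.mem_map.mp hS
  exact cayley_mem (hl T hT)

theorem continuous_N_rotListProd {l : List (Mat2 d)} (hl : ∀ T ∈ l, T ∈ HSp d) :
    Continuous fun θ => N d (rotListProd l θ) := by
  simp only [N_rotListProd hl]
  have h := (differentiable_det_scaledProd_block (l.map cayley)).continuous
  refine Continuous.log ?_ fun θ => ?_
  · exact (h.comp (by fun_prop : Continuous fun θ : ℝ =>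
      Complex.exp (2 * Real.pi * θ * Complex.I))).norm
  · rw [norm_ne_zero_iff]
    refine det_scaledProd_block_ne_zero (map_cayley_mem hl) (le_of_eq ?_)
    rw [Complex.norm_exp]
    simp

/-- The averaging formula for `N_d` along finite products. -/
theorem integral_N_rotListProd {l : List (Mat2 d)} (hl : ∀ T ∈ l, T ∈ HSp d) :
    ∫ θ in (0 : ℝ)..1, N d (rotListProd l θ) = (l.map (N d)).sum := by
  simp only [N_rotListProd hl]
  rw [circleAverage_eq_integral_exp
    (fun z => Real.log ‖(scaledProd (l.map cayley) z).toBlocks₂₂.det‖),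
    circleAverage_log_norm_det (map_cayley_mem hl), List.map_map]
  congr 1
  exact List.map_congr_left fun T hT => (N_eq_log_norm_det (hl T hT)).symm

end RotatedProducts

/-! ### Comparison of N_d, log ‖Λ^k T‖ and log ‖T‖. -/

section Bounds

variable {d : ℕ}

theorem opNorm_eq_norm (T : Mat2 d) : opNorm T = ‖T‖ := rfl

theorem opNorm_unitary_mul {U : Mat2 d} (hU : U ∈ unitary (Mat2 d)) (T : Mat2 d) :
    opNorm (U * T) = opNorm T := by
  rw [opNorm_eq_norm, opNorm_eq_norm, CStarRing.norm_mem_unitary_mul _ hU]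

theorem sv_nonneg (T : Mat2 d) (i : ℕ) : 0 ≤ sv T i :=
  LinearMap.singularValues_nonneg _ _

theorem sv_le_opNorm (T : Mat2 d) {i : ℕ} (hi : i < d + d) : sv T i ≤ opNorm T := by
  obtain ⟨U, hU, h⟩ := exists_unitary_conjTranspose_mul_self T
  have hi' : i < Fintype.card (Fin d ⊕ Fin d) := by rwa [card_sum_fin]
  have h1 := norm_unitary_conj hU (diagonal (fun i =>
      (((toEuclideanLin T).singularValues
        ((Fintype.equivOfCardEq (Fintype.card_fin (Fintype.card (Fin d ⊕ Fin d)))).symm i) ^ 2 : ℝ)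
          : ℂ)))
  rw [← h, l2_opNorm_conjTranspose_mul_self, l2_opNorm_diagonal] at h1
  have h2 := norm_le_pi_norm (fun i =>
      (((toEuclideanLin T).singularValues
        ((Fintype.equivOfCardEq (Fintype.card_fin (Fintype.card (Fin d ⊕ Fin d)))).symm i) ^ 2 : ℝ)
          : ℂ)) (Fintype.equivOfCardEq (Fintype.card_fin _) ⟨i, hi'⟩)
  rw [← h1, Equiv.symm_apply_apply, Complex.norm_real, Real.norm_of_nonneg (sq_nonneg _),
    ← sq] at h2
  exact (pow_le_pow_iff_left₀ (sv_nonneg T i) (norm_nonneg _) two_ne_zero).mp h2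

theorem norm_compound_eq_prod_sv {k : ℕ} (hk : k ≤ d) (T : Mat2 d) :
    ‖compound k T‖ = ∏ i ∈ Finset.range k, sv T i :=
  norm_compound (by rw [card_sum_fin]; omega) T

theorem one_le_norm_compound {k : ℕ} (hk : k ≤ d) {T : Mat2 d} (hT : T ∈ HSp d) :
    1 ≤ ‖compound k T‖ := by
  rw [norm_compound_eq_prod_sv hk]
  have h : ∏ _i ∈ Finset.range k, (1 : ℝ) ≤ ∏ i ∈ Finset.range k, sv T i :=
    Finset.prod_le_prod (fun _ _ => zero_le_one) fun i hi =>
      one_le_sv hT ((Finset.mem_range.mp hi).trans_le hk)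
  simpa using h

theorem log_norm_compound {k : ℕ} (hk : k ≤ d) {T : Mat2 d} (hT : T ∈ HSp d) :
    Real.log ‖compound k T‖ = ∑ i ∈ Finset.range k, Real.log (sv T i) := by
  rw [norm_compound_eq_prod_sv hk, Real.log_prod]
  intro i hi
  have := Finset.mem_range.mp hi
  exact (sv_pos hT (by omega)).ne'

theorem log_norm_compound_nonneg {k : ℕ} (hk : k ≤ d) {T : Mat2 d} (hT : T ∈ HSp d) :
    0 ≤ Real.log ‖compound k T‖ :=
  Real.log_nonneg (one_le_norm_compound hk hT)

theorem log_norm_compound_le {k : ℕ} (hk : k ≤ d) {T : Mat2 d} (hT : T ∈ HSp d) :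
    Real.log ‖compound k T‖ ≤ k * Real.log (opNorm T) := by
  rw [log_norm_compound hk hT]
  have h : ∀ i ∈ Finset.range k, Real.log (sv T i) ≤ Real.log (opNorm T) := by
    intro i hi
    have := Finset.mem_range.mp hi
    exact Real.log_le_log (sv_pos hT (by omega)) (sv_le_opNorm T (by omega))
  simpa using Finset.sum_le_sum h

theorem log_norm_compound_mul_le {k : ℕ} (hk : k ≤ d) {S T : Mat2 d} (hS : S ∈ HSp d)
    (hT : T ∈ HSp d) :
    Real.log ‖compound k (S * T)‖ ≤ Real.log ‖compound k S‖ + Real.log ‖compound k T‖ := by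
  have h1 := zero_lt_one.trans_le (one_le_norm_compound hk hS)
  have h2 := zero_lt_one.trans_le (one_le_norm_compound hk hT)
  have h3 := zero_lt_one.trans_le (one_le_norm_compound hk (mul_mem_HSp hS hT))
  rw [← Real.log_mul h1.ne' h2.ne']
  refine Real.log_le_log h3 ?_
  rw [compound_mul]
  exact norm_mul_le _ _

theorem N_nonneg {T : Mat2 d} (hT : T ∈ HSp d) : 0 ≤ N d T := by
  refine Finset.sum_nonneg fun i hi => Real.log_nonneg ?_
  have h := one_le_sv hT (Finset.mem_range.mp hi)
  have h0 : 0 < sv T i := by linarith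
  have h1 : sv T i * (sv T i)⁻¹ = 1 := mul_inv_cancel₀ h0.ne'
  have h2 : 0 < (sv T i)⁻¹ := inv_pos.mpr h0
  nlinarith [sq_nonneg (sv T i - (sv T i)⁻¹)]

theorem N_le_log_norm_compound {T : Mat2 d} (hT : T ∈ HSp d) :
    N d T ≤ Real.log ‖compound d T‖ := by
  rw [log_norm_compound le_rfl hT]
  refine Finset.sum_le_sum fun i hi => ?_
  have h := one_le_sv hT (Finset.mem_range.mp hi)
  have h1 : (sv T i)⁻¹ ≤ 1 := inv_le_one_of_one_le₀ h
  have h2 : 0 < (sv T i)⁻¹ := by positivity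
  exact Real.log_le_log (by positivity) (by linarith)

/-- Each of the d terms loses at most log 2, since σ ≤ 2 · (σ + σ⁻¹)/2. -/
theorem log_norm_compound_le_N_add {T : Mat2 d} (hT : T ∈ HSp d) :
    Real.log ‖compound d T‖ ≤ N d T + d * Real.log 2 := by
  have h3 : (d : ℝ) * Real.log 2 = ∑ i ∈ Finset.range d, Real.log 2 := by simp
  rw [log_norm_compound le_rfl hT, h3, N, ← Finset.sum_add_distrib]
  refine Finset.sum_le_sum fun i hi => ?_
  have h := one_le_sv hT (Finset.mem_range.mp hi)
  have h2 : 0 < (sv T i)⁻¹ := by positivity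
  rw [← Real.log_mul (by positivity) (by norm_num)]
  exact Real.log_le_log (by positivity) (by linarith)

end Bounds

/-! ### Limits of averages and dominated convergence. -/

section Averages

theorem tendsto_div_nat_of_le_add {u v : ℕ → ℝ} {c ℓ : ℝ} (h1 : ∀ n, u n ≤ v n)
    (h2 : ∀ n, v n ≤ u n + c) (hv : Tendsto (fun n : ℕ => v n / n) atTop (𝓝 ℓ)) :
    Tendsto (fun n : ℕ => u n / n) atTop (𝓝 ℓ) := by
  have h3 : Tendsto (fun n : ℕ => v n / n - c / n) atTop (𝓝 ℓ) := by
    simpa using hv.sub (tendsto_const_div_atTop_nhds_zero_nat c)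
  refine tendsto_of_tendsto_of_tendsto_of_le_of_le h3 hv (fun n => ?_) fun n => ?_
  · rw [← sub_div]
    exact div_le_div_of_nonneg_right (by linarith [h2 n]) (Nat.cast_nonneg n)
  · exact div_le_div_of_nonneg_right (h1 n) (Nat.cast_nonneg n)

/-- Used for averages of the form a_n / n. At n = 0 these are 0 by convention, so the integral is
prescribed only for n ≠ 0, while the bound C has to cover every n. -/
theorem intervalIntegral_eq_of_tendsto {F : ℕ → ℝ → ℝ} {G : ℝ → ℝ} {c C : ℝ}
    (hF : ∀ n, AEStronglyMeasurable (F n) (volume.restrict (Set.uIoc 0 1)))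
    (hC : ∀ n θ, |F n θ| ≤ C) (hG : ∀ θ, Tendsto (fun n => F n θ) atTop (𝓝 (G θ)))
    (hc : ∀ n, n ≠ 0 → ∫ θ in (0 : ℝ)..1, F n θ = c) :
    IntervalIntegrable G volume 0 1 ∧ ∫ θ in (0 : ℝ)..1, G θ = c := by
  constructor
  · have hGm : AEStronglyMeasurable G (volume.restrict (Set.uIoc 0 1)) :=
      aestronglyMeasurable_of_tendsto_ae atTop hF (ae_of_all _ hG)
    refine IntervalIntegrable.mono_fun (g := G) (f := fun _ => C) (by simp) hGm
      (ae_of_all _ fun θ => ?_)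
    refine le_trans ?_ (le_abs_self C)
    exact le_of_tendsto (hG θ).abs (Eventually.of_forall fun n => hC n θ)
  · have h := intervalIntegral.tendsto_integral_filter_of_dominated_convergence
      (μ := volume) (a := 0) (b := 1) (F := F) (f := G) (l := atTop) (fun _ => C)
      (Eventually.of_forall hF) (Eventually.of_forall fun n => ae_of_all _ fun θ _ => hC n θ)
      (by simp) (ae_of_all _ fun θ _ => hG θ)
    refine tendsto_nhds_unique (h.congr' ?_) tendsto_const_nhds
    filter_upwards [eventually_ne_atTop 0] with n hn using hc n hn

end Averages

/-! ### The spectral radius of Λ^d along finite products. -/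

section SpectralRadius

variable {d : ℕ}

theorem pow_mem_HSp {T : Mat2 d} (hT : T ∈ HSp d) (m : ℕ) : T ^ m ∈ HSp d := by
  induction m with
  | zero => simpa using one_mem_HSp d
  | succ m ih => rw [pow_succ]; exact mul_mem_HSp ih hT

theorem tendsto_log_norm_compound_pow {T : Mat2 d} (hT : T ∈ HSp d) :
    Tendsto (fun m : ℕ => Real.log ‖compound d (T ^ m)‖ / m) atTop
      (𝓝 (Real.log (rhoExt d T))) := by
  have : CompleteSpace (Matrix (Set.powersetCard (Fin (Fintype.card (Fin d ⊕ Fin d))) d)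
      (Set.powersetCard (Fin (Fintype.card (Fin d ⊕ Fin d))) d) ℂ) :=
    FiniteDimensional.complete ℂ _
  have h := spectrum.pow_norm_pow_one_div_tendsto_nhds_spectralRadius (compound d T)
  have hfin : spectralRadius ℂ (compound d T) ≠ ⊤ := by
    refine ne_top_of_le_ne_top ?_ (spectrum.spectralRadius_le_pow_nnnorm_pow_one_div ℂ
      (compound d T) 0)
    simp [ENNReal.mul_eq_top]
  have h1 : Tendsto (fun m : ℕ => ‖compound d T ^ m‖ ^ (1 / m : ℝ)) atTop
      (𝓝 (rhoExt d T)) := by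
    rw [rhoExt, spectralRadius_exteriorPower_map]
    refine ((ENNReal.tendsto_toReal hfin).comp h).congr fun m => ?_
    exact ENNReal.toReal_ofReal (by positivity)
  have h2 : ∀ m : ℕ, 1 ≤ ‖compound d T ^ m‖ := fun m => by
    rw [← compound_pow]
    exact one_le_norm_compound le_rfl (pow_mem_HSp hT m)
  -- Keeps the limit away from 0, where the logarithm is not continuous.
  have h3 : 1 ≤ rhoExt d T :=
    ge_of_tendsto h1 (Eventually.of_forall fun m => Real.one_le_rpow (h2 m) (by positivity))
  refine (h1.log (by positivity)).congr fun m => ?_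
  rw [compound_pow, Real.log_rpow (by linarith [h2 m])]
  ring

theorem tendsto_N_pow {T : Mat2 d} (hT : T ∈ HSp d) :
    Tendsto (fun m : ℕ => N d (T ^ m) / m) atTop (𝓝 (Real.log (rhoExt d T))) :=
  tendsto_div_nat_of_le_add (fun m => N_le_log_norm_compound (pow_mem_HSp hT m))
    (fun m => log_norm_compound_le_N_add (pow_mem_HSp hT m)) (tendsto_log_norm_compound_pow hT)

/-- A power is again a rotated product with the same θ, so the averaging formula applies to every
power. -/
theorem rotListProd_pow (l : List (Mat2 d)) (θ : ℝ) (m : ℕ) :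
    rotListProd l θ ^ m = rotListProd (List.replicate m l).flatten θ := by
  simp [rotListProd, List.map_flatten, List.prod_flatten]

theorem log_norm_compound_rotListProd_le {l : List (Mat2 d)} (hl : ∀ T ∈ l, T ∈ HSp d) (θ : ℝ) :
    Real.log ‖compound d (rotListProd l θ)‖
      ≤ (l.map fun T => d * Real.log (opNorm T)).sum := by
  induction l with
  | nil =>
    have := log_norm_compound_le le_rfl (one_mem_HSp d)
    -- Only an inequality for the norm is used: for d = 0 the identity has norm 0.
    have h1 : Real.log (opNorm (1 : Mat2 d)) ≤ 0 := by
      refine Real.log_nonpos (norm_nonneg _) ?_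
      rw [opNorm, map_one]
      exact ContinuousLinearMap.norm_id_le
    simp only [rotListProd, List.map_nil, List.prod_nil, List.sum_nil]
    nlinarith [(Nat.cast_nonneg d : (0 : ℝ) ≤ d)]
  | cons S l ih =>
    have h : rotListProd (S :: l) θ = rot d θ * S * rotListProd l θ := by simp [rotListProd]
    have hS : rot d θ * S ∈ HSp d := mul_mem_HSp (rot_mem_HSp d θ) (hl S (by simp))
    have hl' : ∀ T ∈ l, T ∈ HSp d := fun T hT => hl T (by simp [hT])
    rw [h, List.map_cons, List.sum_cons]
    refine (log_norm_compound_mul_le le_rfl hS (rotListProd_mem hl' θ)).trans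
      (add_le_add ?_ (ih hl'))
    rw [← opNorm_unitary_mul (rot_mem_unitary d θ) S]
    exact log_norm_compound_le le_rfl hS

/-- The averaging formula for the spectral radius of `Λ^d` along finite products. -/
theorem integral_log_rhoExt_rotListProd {l : List (Mat2 d)} (hl : ∀ T ∈ l, T ∈ HSp d) :
    IntervalIntegrable (fun θ => Real.log (rhoExt d (rotListProd l θ))) volume 0 1 ∧
      ∫ θ in (0 : ℝ)..1, Real.log (rhoExt d (rotListProd l θ)) = (l.map (N d)).sum := by
  have hmem : ∀ m : ℕ, ∀ T ∈ (List.replicate m l).flatten, T ∈ HSp d := by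
    intro m T hT
    obtain ⟨l', hl', hT⟩ := List.mem_flatten.mp hT
    rw [List.eq_of_mem_replicate hl'] at hT
    exact hl T hT
  refine intervalIntegral_eq_of_tendsto
    (F := fun m θ => N d (rotListProd l θ ^ m) / m)
    (C := (l.map fun T => d * Real.log (opNorm T)).sum) ?_ ?_ ?_ ?_
  · intro m
    simp only [rotListProd_pow]
    exact ((continuous_N_rotListProd (hmem m)).div_const _).aestronglyMeasurable
  · intro m θ
    have hp := pow_mem_HSp (rotListProd_mem hl θ) m
    rw [abs_of_nonneg (div_nonneg (N_nonneg hp) (Nat.cast_nonneg m))]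
    rcases Nat.eq_zero_or_pos m with rfl | hm
    · have := (log_norm_compound_nonneg le_rfl (rotListProd_mem hl θ)).trans
        (log_norm_compound_rotListProd_le hl θ)
      simpa using this
    · rw [div_le_iff₀ (by exact_mod_cast hm)]
      refine (N_le_log_norm_compound hp).trans ?_
      rw [rotListProd_pow]
      refine (log_norm_compound_rotListProd_le (hmem m) θ).trans (le_of_eq ?_)
      simp [List.map_flatten, List.sum_flatten, mul_comm]
  · intro θ
    exact tendsto_N_pow (rotListProd_mem hl θ)
  · intro m hm
    simp only [rotListProd_pow, intervalIntegral.integral_div]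
    rw [integral_N_rotListProd (hmem m)]
    have : (m : ℝ) ≠ 0 := by exact_mod_cast hm
    simp [List.map_flatten, List.sum_flatten]
    field_simp

end SpectralRadius

/-! ### Iterates of a cocycle as rotated products along orbits. -/

section Iterates

variable {X : Type*} {d : ℕ} {f : X → X} {A : X → Mat2 d}

theorem iter_mem (hA : ∀ x, A x ∈ HSp d) (n : ℕ) (x : X) : iter f A n x ∈ HSp d := by
  induction n with
  | zero => exact one_mem_HSp d
  | succ n ih => exact mul_mem_HSp (hA _) ih

theorem iter_succ (f : X → X) (A : X → Mat2 d) (n : ℕ) (x : X) :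
    iter f A (n + 1) x = A (f^[n] x) * iter f A n x := rfl

theorem iter_add (f : X → X) (A : X → Mat2 d) (m n : ℕ) (x : X) :
    iter f A (m + n) x = iter f A m (f^[n] x) * iter f A n x := by
  induction m with
  | zero => simp [iter]
  | succ m ih =>
    rw [Nat.succ_add, iter, iter, ih, ← mul_assoc, Function.iterate_add_apply]

theorem log_norm_compound_iter_le (hA : ∀ x, A x ∈ HSp d) {k : ℕ} (hk : k ≤ d) (n : ℕ) (x : X) :
    Real.log ‖compound k (iter f A n x)‖
      ≤ ∑ j ∈ Finset.range n, k * Real.log (opNorm (A (f^[j] x))) := by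
  induction n with
  | zero =>
    rw [iter, log_norm_compound hk (one_mem_HSp d)]
    refine (Finset.sum_nonpos fun i hi => ?_).trans (le_of_eq (by simp))
    have := Finset.mem_range.mp hi
    refine Real.log_nonpos (sv_nonneg _ _) ((sv_le_opNorm _ (by omega)).trans ?_)
    rw [opNorm, map_one]
    exact ContinuousLinearMap.norm_id_le
  | succ n ih =>
    rw [Finset.sum_range_succ, iter_succ, add_comm]
    exact (log_norm_compound_mul_le hk (hA _) (iter_mem hA n x)).trans
      (add_le_add (log_norm_compound_le hk (hA _)) ih)

/-- Expresses single exponents through the submultiplicative norms ‖Λ^k T‖. -/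
theorem log_sv_eq {k : ℕ} (hk : k < d) {T : Mat2 d} (hT : T ∈ HSp d) :
    Real.log (sv T k) = Real.log ‖compound (k + 1) T‖ - Real.log ‖compound k T‖ := by
  rw [log_norm_compound hk hT, log_norm_compound hk.le hT, Finset.sum_range_succ]
  ring

/-- The factors of `A_n(x)` in the order of multiplication. -/
def orbitList (f : X → X) (A : X → Mat2 d) : ℕ → X → List (Mat2 d)
  | 0, _ => []
  | n + 1, x => A (f^[n] x) :: orbitList f A n x

theorem iter_rot_mul (f : X → X) (A : X → Mat2 d) (θ : ℝ) (n : ℕ) (x : X) :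
    iter f (fun y => rot d θ * A y) n x = rotListProd (orbitList f A n x) θ := by
  induction n with
  | zero => rfl
  | succ n ih => rw [iter, ih]; simp [rotListProd, orbitList]

theorem orbitList_mem (hA : ∀ x, A x ∈ HSp d) (n : ℕ) (x : X) :
    ∀ T ∈ orbitList f A n x, T ∈ HSp d := by
  induction n with
  | zero => simp [orbitList]
  | succ n ih =>
    intro T hT
    rcases List.mem_cons.mp hT with rfl | hT
    · exact hA _
    · exact ih T hT

theorem sum_map_orbitList (f : X → X) (A : X → Mat2 d) (g : Mat2 d → ℝ) (n : ℕ) (x : X) :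
    ((orbitList f A n x).map g).sum = ∑ j ∈ Finset.range n, g (A (f^[j] x)) := by
  induction n with
  | zero => simp [orbitList]
  | succ n ih => rw [Finset.sum_range_succ, ← ih, orbitList, List.map_cons, List.sum_cons, add_comm]

theorem N_iter_rot_mul_le (hA : ∀ x, A x ∈ HSp d) (n : ℕ) (θ : ℝ) (x : X) :
    N d (iter f (fun y => rot d θ * A y) n x)
      ≤ ∑ j ∈ Finset.range n, d * Real.log (opNorm (A (f^[j] x))) := by
  have hB : ∀ x, rot d θ * A x ∈ HSp d := fun x => mul_mem_HSp (rot_mem_HSp d θ) (hA x)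
  refine (N_le_log_norm_compound (iter_mem hB n x)).trans
    ((log_norm_compound_iter_le hB le_rfl n x).trans (le_of_eq ?_))
  simp only [opNorm_unitary_mul (rot_mem_unitary d θ)]

end Iterates

/-! ### Lyapunov exponents and their average over θ. -/

section Cocycles

variable {X : Type*} [MeasurableSpace X] {μ : Measure X} {d : ℕ} {f : X → X} {A : X → Mat2 d}

theorem integrable_comp_iterate (hf : MeasurePreserving f μ μ) {g : X → ℝ} (hg : Integrable g μ)
    (n : ℕ) : Integrable (fun x => g (f^[n] x)) μ :=
  (hf.iterate n).integrable_comp_of_integrable hg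

theorem integral_comp_iterate (hf : MeasurePreserving f μ μ) {g : X → ℝ} (hg : Integrable g μ)
    (n : ℕ) : ∫ x, g (f^[n] x) ∂μ = ∫ x, g x ∂μ := by
  have h := (hf.iterate n).map_eq
  conv_rhs => rw [← h]
  rw [integral_map (hf.iterate n).measurable.aemeasurable (by rw [h]; exact hg.aestronglyMeasurable)]

theorem measurable_comp_of_entries {Y I : Type*} [MeasurableSpace Y] [Fintype I]
    [DecidableEq I] {g : Matrix I I ℂ → ℝ} (hg : Continuous g) {B : Y → Matrix I I ℂ}
    (hB : ∀ i j, Measurable fun y => B y i j) : Measurable fun y => g (B y) := by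
  have h1 : Continuous fun M : I → I → ℂ => g (Matrix.of M) := hg
  have h2 : Measurable fun y i j => B y i j :=
    measurable_pi_lambda _ fun i => measurable_pi_lambda _ fun j => hB i j
  exact h1.measurable.comp h2

theorem continuous_norm_det_cayley :
    Continuous fun T : Mat2 d => ‖(cayley T).toBlocks₂₂.det‖ := by
  refine (Continuous.matrix_det ?_).norm
  refine Continuous.matrix_submatrix (A := fun T : Mat2 d => cayley T) ?_ Sum.inr Sum.inr
  unfold cayley
  fun_prop

/-- The determinant formula, continuous in T before the logarithm, bypasses measurability of the
singular values. -/
theorem measurable_N {Y : Type*} [MeasurableSpace Y] {B : Y → Mat2 d} (hB : ∀ y, B y ∈ HSp d)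
    (hm : ∀ i j, Measurable fun y => B y i j) : Measurable fun y => N d (B y) := by
  simp only [N_eq_log_norm_det (hB _)]
  exact (measurable_comp_of_entries continuous_norm_det_cayley hm).log

theorem measurable_log_norm_compound {Y : Type*} [MeasurableSpace Y] {B : Y → Mat2 d} (k : ℕ)
    (hm : ∀ i j, Measurable fun y => B y i j) :
    Measurable fun y => Real.log ‖compound k (B y)‖ :=
  (measurable_comp_of_entries (continuous_compound k).norm hm).log

theorem measurable_entry_mul {Y : Type*} [MeasurableSpace Y] {B C : Y → Mat2 d}
    (hB : ∀ i j, Measurable fun y => B y i j) (hC : ∀ i j, Measurable fun y => C y i j)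
    (i j : Fin d ⊕ Fin d) : Measurable fun y => (B y * C y) i j := by
  simp only [mul_apply]
  exact Finset.measurable_fun_sum _ fun k _ => (hB i k).mul (hC k j)

theorem measurable_rot (d : ℕ) (i j : Fin d ⊕ Fin d) : Measurable fun θ => rot d θ i j := by
  have h : Continuous fun θ => rot d θ := by
    unfold rot
    fun_prop
  exact (h.matrix_elem i j).measurable

/-- The parameter in Y plays the role of θ: Fubini needs joint measurability in (θ, x). -/
theorem measurable_iter_uncurry {Y : Type*} [MeasurableSpace Y] (hf : Measurable f)
    {B : Y → X → Mat2 d} (hB : ∀ i j, Measurable fun p : Y × X => B p.1 p.2 i j) (n : ℕ)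
    (i j : Fin d ⊕ Fin d) : Measurable fun p : Y × X => iter f (B p.1) n p.2 i j := by
  induction n generalizing i j with
  | zero => exact measurable_const
  | succ n ih =>
    refine measurable_entry_mul (B := fun p : Y × X => B p.1 (f^[n] p.2)) (fun i j => ?_) ih i j
    exact (hB i j).comp (measurable_fst.prodMk ((hf.iterate n).comp measurable_snd))

theorem measurable_iter (hf : Measurable f) (hA : ∀ i j, Measurable fun x => A x i j) (n : ℕ)
    (i j : Fin d ⊕ Fin d) : Measurable fun x => iter f A n x i j := by
  have h := measurable_iter_uncurry (Y := Unit) hf (B := fun _ => A)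
    (fun i j => (hA i j).comp measurable_snd) n i j
  exact h.comp (measurable_const.prodMk measurable_id : Measurable fun x : X => ((), x))

theorem IsLogIntegrable.integrable_bound (hA : IsLogIntegrable μ A)
    (hf : MeasurePreserving f μ μ) (c : ℝ) (n : ℕ) :
    Integrable (fun x => ∑ j ∈ Finset.range n, c * Real.log (opNorm (A (f^[j] x)))) μ :=
  integrable_finsetSum _ fun j _ =>
    (integrable_comp_iterate hf hA.integrable_log j).const_mul c

theorem IsLogIntegrable.integral_bound (hA : IsLogIntegrable μ A)
    (hf : MeasurePreserving f μ μ) (c : ℝ) (n : ℕ) :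
    ∫ x, ∑ j ∈ Finset.range n, c * Real.log (opNorm (A (f^[j] x))) ∂μ
      = n * (c * ∫ x, Real.log (opNorm (A x)) ∂μ) := by
  rw [integral_finsetSum _ fun j _ =>
    (integrable_comp_iterate hf hA.integrable_log j).const_mul c]
  have h : ∀ j, ∫ x, c * Real.log (opNorm (A (f^[j] x))) ∂μ
      = c * ∫ x, Real.log (opNorm (A x)) ∂μ := by
    intro j
    rw [integral_const_mul]
    congr 1
    exact integral_comp_iterate hf hA.integrable_log j
  simp [h]

theorem IsLogIntegrable.integrable_log_norm_compound_iter (hA : IsLogIntegrable μ A)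
    (hf : MeasurePreserving f μ μ) {k : ℕ} (hk : k ≤ d) (n : ℕ) :
    Integrable (fun x => Real.log ‖compound k (iter f A n x)‖) μ := by
  refine (hA.integrable_bound hf k n).mono'
    (measurable_log_norm_compound k
      (measurable_iter hf.measurable hA.measurable n)).aestronglyMeasurable (ae_of_all _ fun x => ?_)
  rw [Real.norm_of_nonneg (log_norm_compound_nonneg hk (iter_mem hA.mem n x))]
  exact log_norm_compound_iter_le hA.mem hk n x

/-- Fekete's lemma: the integrals are subadditive by invariance of μ, and nonnegative because ‖Λ^k
T‖ ≥ 1 on `HSp d`, so the limit is finite. -/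
theorem IsLogIntegrable.exists_tendsto (hA : IsLogIntegrable μ A)
    (hf : MeasurePreserving f μ μ) {k : ℕ} (hk : k ≤ d) :
    ∃ ℓ, Tendsto (fun n : ℕ => (∫ x, Real.log ‖compound k (iter f A n x)‖ ∂μ) / n) atTop
      (𝓝 ℓ) := by
  have hsub : Subadditive fun n => ∫ x, Real.log ‖compound k (iter f A n x)‖ ∂μ := by
    intro m n
    have h1 : ∫ x, Real.log ‖compound k (iter f A m (f^[n] x))‖ ∂μ
        = ∫ x, Real.log ‖compound k (iter f A m x)‖ ∂μ :=
      integral_comp_iterate hf (hA.integrable_log_norm_compound_iter hf hk m) n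
    have hi1 := integrable_comp_iterate hf (hA.integrable_log_norm_compound_iter hf hk m) n
    have hi2 := hA.integrable_log_norm_compound_iter hf hk n
    simp only
    rw [← h1, ← integral_add hi1 hi2]
    refine integral_mono (hA.integrable_log_norm_compound_iter hf hk (m + n)) (hi1.add hi2)
      fun x => ?_
    simp only [iter_add]
    exact log_norm_compound_mul_le hk (iter_mem hA.mem _ _) (iter_mem hA.mem _ _)
  refine ⟨_, hsub.tendsto_lim ⟨0, ?_⟩⟩
  rintro _ ⟨n, rfl⟩
  exact div_nonneg (integral_nonneg fun x =>
    log_norm_compound_nonneg hk (iter_mem hA.mem n x)) (Nat.cast_nonneg n)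

theorem IsLogIntegrable.integrable_log_sv_iter (hA : IsLogIntegrable μ A)
    (hf : MeasurePreserving f μ μ) {k : ℕ} (hk : k < d) (n : ℕ) :
    Integrable (fun x => Real.log (sv (iter f A n x) k)) μ := by
  simp only [log_sv_eq hk (iter_mem hA.mem _ _)]
  exact (hA.integrable_log_norm_compound_iter hf hk n).sub
    (hA.integrable_log_norm_compound_iter hf hk.le n)

theorem IsLogIntegrable.lyapAvg_eq (hA : IsLogIntegrable μ A)
    (hf : MeasurePreserving f μ μ) {k : ℕ} (hk : k < d) (n : ℕ) :
    lyapAvg μ f A k n = (∫ x, Real.log ‖compound (k + 1) (iter f A n x)‖ ∂μ) / n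
      - (∫ x, Real.log ‖compound k (iter f A n x)‖ ∂μ) / n := by
  rw [lyapAvg]
  simp only [log_sv_eq hk (iter_mem hA.mem _ _)]
  rw [integral_sub (hA.integrable_log_norm_compound_iter hf hk n)
    (hA.integrable_log_norm_compound_iter hf hk.le n)]
  ring

theorem IsLogIntegrable.tendsto_lyapAvg (hA : IsLogIntegrable μ A)
    (hf : MeasurePreserving f μ μ) {k : ℕ} (hk : k < d) :
    Tendsto (lyapAvg μ f A k) atTop (𝓝 (lyap μ f A k)) := by
  obtain ⟨a, ha⟩ := hA.exists_tendsto hf (k := k + 1) hk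
  obtain ⟨b, hb⟩ := hA.exists_tendsto hf hk.le
  have h : Tendsto (lyapAvg μ f A k) atTop (𝓝 (a - b)) :=
    (ha.sub hb).congr fun n => (hA.lyapAvg_eq hf hk n).symm
  exact tendsto_nhds_limUnder ⟨_, h⟩

theorem IsLogIntegrable.tendsto_lyapSum [IsProbabilityMeasure μ] (hA : IsLogIntegrable μ A)
    (hf : MeasurePreserving f μ μ) :
    Tendsto (fun n : ℕ => (∫ x, N d (iter f A n x) ∂μ) / n) atTop (𝓝 (lyapSum μ f A d)) := by
  have hint : ∀ n, Integrable (fun x => N d (iter f A n x)) μ := by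
    intro n
    refine (hA.integrable_log_norm_compound_iter hf le_rfl n).mono'
      (measurable_N (iter_mem hA.mem n)
        (measurable_iter hf.measurable hA.measurable n)).aestronglyMeasurable
      (ae_of_all _ fun x => ?_)
    rw [Real.norm_of_nonneg (N_nonneg (iter_mem hA.mem n x))]
    exact N_le_log_norm_compound (iter_mem hA.mem n x)
  refine tendsto_div_nat_of_le_add (c := d * Real.log 2)
    (v := fun n => ∫ x, Real.log ‖compound d (iter f A n x)‖ ∂μ) (fun n => ?_) (fun n => ?_) ?_
  · exact integral_mono (hint n) (hA.integrable_log_norm_compound_iter hf le_rfl n)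
      fun x => N_le_log_norm_compound (iter_mem hA.mem n x)
  · have h : ∫ x, (N d (iter f A n x) + d * Real.log 2) ∂μ
        = (∫ x, N d (iter f A n x) ∂μ) + d * Real.log 2 := by
      rw [integral_add (hint n) (integrable_const _)]
      simp
    rw [← h]
    exact integral_mono (hA.integrable_log_norm_compound_iter hf le_rfl n)
      ((hint n).add (integrable_const _))
      fun x => log_norm_compound_le_N_add (iter_mem hA.mem n x)
  · refine (tendsto_finsetSum (Finset.range d) fun k hk =>
      hA.tendsto_lyapAvg hf (Finset.mem_range.mp hk)).congr fun n => ?_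
    simp only [lyapAvg]
    rw [← Finset.mul_sum, ← integral_finsetSum _ fun k hk =>
      hA.integrable_log_sv_iter hf (Finset.mem_range.mp hk) n]
    simp only [log_norm_compound le_rfl (iter_mem hA.mem _ _)]
    ring

theorem IsLogIntegrable.integrable_N (hA : IsLogIntegrable μ A) :
    Integrable (fun x => N d (A x)) μ := by
  refine (hA.integrable_log.const_mul (d : ℝ)).mono'
    (measurable_N hA.mem hA.measurable).aestronglyMeasurable (ae_of_all _ fun x => ?_)
  rw [Real.norm_of_nonneg (N_nonneg (hA.mem x))]
  exact (N_le_log_norm_compound (hA.mem x)).trans (log_norm_compound_le le_rfl (hA.mem x))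

theorem IsLogIntegrable.rot_mul (hA : IsLogIntegrable μ A) (θ : ℝ) :
    IsLogIntegrable μ fun x => rot d θ * A x where
  mem x := mul_mem_HSp (rot_mem_HSp d θ) (hA.mem x)
  measurable := measurable_entry_mul (fun _ _ => measurable_const) hA.measurable
  integrable_log := by
    simp only [opNorm_unitary_mul (rot_mem_unitary d θ)]
    exact hA.integrable_log

theorem measurable_N_iter_rot_mul (hf : Measurable f) (hA : ∀ x, A x ∈ HSp d)
    (hm : ∀ i j, Measurable fun x => A x i j) (n : ℕ) :
    Measurable fun p : ℝ × X => N d (iter f (fun y => rot d p.1 * A y) n p.2) := by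
  refine measurable_N (fun p => iter_mem (fun x => mul_mem_HSp (rot_mem_HSp d _) (hA x)) n p.2) ?_
  refine measurable_iter_uncurry hf (B := fun θ y => rot d θ * A y) ?_ n
  exact measurable_entry_mul (fun i j => (measurable_rot d i j).comp measurable_fst)
    fun i j => (hm i j).comp measurable_snd

/-- After exchanging the integrals, the inner one is the finite-product formula along the orbit of
x; invariance makes its n terms equal in mean. -/
theorem IsLogIntegrable.integral_integral_N_iter [IsProbabilityMeasure μ]
    (hA : IsLogIntegrable μ A) (hf : MeasurePreserving f μ μ) (n : ℕ) :
    ∫ θ in (0 : ℝ)..1, ∫ x, N d (iter f (fun y => rot d θ * A y) n x) ∂μ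
      = n * ∫ x, N d (A x) ∂μ := by
  have hint : Integrable (fun p : ℝ × X => N d (iter f (fun y => rot d p.1 * A y) n p.2))
      ((volume.restrict (Set.Ioc (0 : ℝ) 1)).prod μ) := by
    -- The dominating function depends on x alone, as rotations preserve the operator norm.
    refine ((hA.integrable_bound hf d n).comp_snd (volume.restrict (Set.Ioc (0 : ℝ) 1))).mono'
      (measurable_N_iter_rot_mul hf.measurable hA.mem hA.measurable n).aestronglyMeasurable
      (ae_of_all _ fun p => ?_)
    rw [Real.norm_of_nonneg (N_nonneg (iter_mem
      (fun x => mul_mem_HSp (rot_mem_HSp d _) (hA.mem x)) n p.2))]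
    exact N_iter_rot_mul_le hA.mem n p.1 p.2
  rw [intervalIntegral.integral_of_le zero_le_one, integral_integral_swap hint]
  simp only [← intervalIntegral.integral_of_le (zero_le_one' ℝ), iter_rot_mul]
  simp only [integral_N_rotListProd (orbitList_mem hA.mem _ _), sum_map_orbitList]
  rw [integral_finsetSum _ fun j _ =>
    integrable_comp_iterate hf hA.integrable_N j]
  have h : ∀ j, ∫ x, N d (A (f^[j] x)) ∂μ = ∫ x, N d (A x) ∂μ := fun j =>
    integral_comp_iterate hf hA.integrable_N j
  simp [h]

/-- The averaging formula for the sum of the top `d` Lyapunov exponents. -/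
theorem IsLogIntegrable.integral_lyapSum [IsProbabilityMeasure μ]
    (hA : IsLogIntegrable μ A) (hf : MeasurePreserving f μ μ) :
    IntervalIntegrable (fun θ => lyapSum μ f (fun y => rot d θ * A y) d) volume 0 1 ∧
      ∫ θ in (0 : ℝ)..1, lyapSum μ f (fun y => rot d θ * A y) d = ∫ x, N d (A x) ∂μ := by
  refine intervalIntegral_eq_of_tendsto
    (F := fun n θ => (∫ x, N d (iter f (fun y => rot d θ * A y) n x) ∂μ) / n)
    (C := d * ∫ x, Real.log (opNorm (A x)) ∂μ) ?_ ?_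
    (fun θ => (hA.rot_mul θ).tendsto_lyapSum hf) ?_
  · intro n
    have h := (measurable_N_iter_rot_mul hf.measurable hA.mem hA.measurable n).stronglyMeasurable
    simp only [div_eq_mul_inv]
    exact (h.integral_prod_right'.mul_const _).aestronglyMeasurable
  · intro n θ
    have hmem := fun x => iter_mem (f := f) (hA.rot_mul θ).mem n x
    have h0 : 0 ≤ ∫ x, N d (iter f (fun y => rot d θ * A y) n x) ∂μ :=
      integral_nonneg fun x => N_nonneg (hmem x)
    rw [abs_of_nonneg (div_nonneg h0 (Nat.cast_nonneg n))]
    have h1 : ∫ x, N d (iter f (fun y => rot d θ * A y) n x) ∂μ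
        ≤ n * (d * ∫ x, Real.log (opNorm (A x)) ∂μ) := by
      rw [← hA.integral_bound hf]
      exact integral_mono_of_nonneg (ae_of_all _ fun x => N_nonneg (hmem x))
        (hA.integrable_bound hf d n) (ae_of_all _ fun x => N_iter_rot_mul_le hA.mem n θ x)
    -- Nonnegativity of the bound is required for n = 0, where the quotient is 0.
    refine div_le_of_le_mul₀ (Nat.cast_nonneg n) ?_ (by rwa [mul_comm])
    rw [← integral_const_mul]
    exact integral_nonneg fun x => (log_norm_compound_nonneg le_rfl (hA.mem x)).trans
      (log_norm_compound_le le_rfl (hA.mem x))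
  · intro n hn
    rw [intervalIntegral.integral_div, hA.integral_integral_N_iter hf]
    have : (n : ℝ) ≠ 0 := by exact_mod_cast hn
    field_simp

end Cocycles

end HSpCocycle

theorem theorem3 (d : ℕ) :
    -- The averaging formula for cocycles; the first conjunct says that the Lyapunov exponents
    -- in it exist (all logarithms are integrable, all limits exist).
    (∀ (X : Type*) [MeasurableSpace X] (μ : Measure X) [IsProbabilityMeasure μ]
      (f : X → X) (_ : MeasurePreserving f μ μ)
      (A : X → HSpCocycle.Mat2 d) (_ : HSpCocycle.IsLogIntegrable μ A),
      (∀ θ ∈ Set.Icc (0 : ℝ) 1, ∀ k < d,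
        (∀ n : ℕ, Integrable (fun x => Real.log (HSpCocycle.sv
          (HSpCocycle.iter f (fun y => HSpCocycle.rot d θ * A y) n x) k)) μ) ∧
        Tendsto (HSpCocycle.lyapAvg μ f (fun y => HSpCocycle.rot d θ * A y) k) atTop
          (𝓝 (HSpCocycle.lyap μ f (fun y => HSpCocycle.rot d θ * A y) k))) ∧
      IntervalIntegrable
        (fun θ => HSpCocycle.lyapSum μ f (fun y => HSpCocycle.rot d θ * A y) d) volume 0 1 ∧
      Integrable (fun x => HSpCocycle.N d (A x)) μ ∧
      ∫ θ in (0 : ℝ)..1, HSpCocycle.lyapSum μ f (fun y => HSpCocycle.rot d θ * A y) d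
        = ∫ x, HSpCocycle.N d (A x) ∂μ) ∧
    -- The formulas for finite products.
    (∀ (n : ℕ) (T : Fin n → HSpCocycle.Mat2 d) (_ : ∀ j, T j ∈ HSpCocycle.HSp d),
      (IntervalIntegrable (fun θ => HSpCocycle.N d (HSpCocycle.rotProd T θ)) volume 0 1 ∧
        ∫ θ in (0 : ℝ)..1, HSpCocycle.N d (HSpCocycle.rotProd T θ)
          = ∑ j, HSpCocycle.N d (T j)) ∧
      (IntervalIntegrable (fun θ => Real.log (HSpCocycle.rhoExt d (HSpCocycle.rotProd T θ)))
          volume 0 1 ∧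
        ∫ θ in (0 : ℝ)..1, Real.log (HSpCocycle.rhoExt d (HSpCocycle.rotProd T θ))
          = ∑ j, HSpCocycle.N d (T j))) := by
  refine ⟨fun X _ μ _ f hf A hA => ⟨fun θ _ k hk => ⟨fun n => ?_, ?_⟩, ?_, ?_, ?_⟩,
    fun n T hT => ?_⟩
  · exact (hA.rot_mul θ).integrable_log_sv_iter hf hk n
  · exact (hA.rot_mul θ).tendsto_lyapAvg hf hk
  · exact (hA.integral_lyapSum hf).1
  · exact hA.integrable_N
  · exact (hA.integral_lyapSum hf).2
  · have hl : ∀ S ∈ List.ofFn T, S ∈ HSpCocycle.HSp d := by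
      intro S hS
      obtain ⟨j, rfl⟩ := (List.mem_ofFn' T S).mp hS
      exact hT j
    have hsum : ((List.ofFn T).map (HSpCocycle.N d)).sum = ∑ j, HSpCocycle.N d (T j) := by
      rw [List.map_ofFn, List.sum_ofFn]
      rfl
    simp only [HSpCocycle.rotProd_eq_rotListProd]
    rw [← hsum]
    exact ⟨⟨(HSpCocycle.continuous_N_rotListProd hl).intervalIntegrable 0 1,
      HSpCocycle.integral_N_rotListProd hl⟩, HSpCocycle.integral_log_rhoExt_rotListProd hl⟩
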